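/- Let $a<b$, let $(\Omega,\mathcal F,\mathbb P)$ be a probability space, and let $u:[a,b]\times\Omega\to\mathbb R$ be a Gaussian random field with spatial correlation function $R(x,y)=\mathbb E\big((u(x)-\mathbb Eu(x))(u(y)-\mathbb Eu(y))\big)$, and write $R_{k,\ell}(x)=\frac{\partial^{k+\ell}R}{\partial x^k\partial y^\ell}(x,x)$ (derivatives at end points of $[a,b]$ are one-sided). Assume: (G1) $u(\cdot,\omega)$ is twice continuously differentiable on $[a,b]$ for $\mathbb P$-almost all $\omega$, and $\mathbb E u(x)=0$ for every $x\in[a,b]$. (G2) $R$ is three times continuously differentiable in each of its two variables in a neighborhood of the diagonal (that is, the partial derivatives $\partial_x^k\partial_y^\ell R$, $0\le k,\ell\le 3$, exist and are continuous on the part of $[a,b]^2$ in an open set containing the diagonal), and the matrix $$\mathcal R(x)=\begin{pmatrix}R_{0,0}(x)&R_{1,0}(x)&R_{2,0}(x)\\R_{1,0}(x)&R_{1,1}(x)&R_{2,1}(x)\\R_{2,0}(x)&R_{2,1}(x)&R_{2,2}(x)\end{pmatrix}$$ is positive definite for every $x\in[a,b]$. Put $\mathcal R^m_{33}=R_{0,0}R_{1,1}-R_{1,0}^2$,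 $\mathcal R^m_{32}=R_{0,0}R_{2,1}-R_{1,0}R_{2,0}$, $\mathcal R^m_{31}=R_{1,0}R_{2,1}-R_{1,1}R_{2,0}$. Fix $x\in[a,b)$ and, for sufficiently small $\delta>0$, let $T(\delta)=(u(x),u(x+\delta/2),u(x+\delta))^t$. Then, for all sufficiently small $\delta>0$, $T(\delta)$ is a centered Gaussian random vector with positive definite covariance matrix $C(\delta)$. Let $0<\lambda_1(\delta)\le\lambda_2(\delta)\le\lambda_3(\delta)$ be the eigenvalues of $C(\delta)$. As $\delta\to0^+$, $$\lambda_1(\delta)=\frac{\det\mathcal R(x)}{96\,\mathcal R^m_{33}(x)}\,\delta^4+O(\delta^5),\qquad \lambda_2(\delta)=\frac{\mathcal R^m_{33}(x)}{2R_{0,0}(x)}\,\delta^2+O(\delta^3),\qquad \lambda_3(\delta)=3R_{0,0}(x)+O(\delta).$$ Corresponding orthonormal eigenvectors $v_1(\delta),v_2(\delta),v_3(\delta)$ can be chosen such that, as $\delta\to0^+$, $$v_1(\delta)\to\tfrac1{\sqrt6}(1,-2,1)^t,\qquad v_2(\delta)\to\tfrac1{\sqrt2}(1,0,-1)^t,\qquad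 v_3(\delta)\to\tfrac1{\sqrt3}(1,1,1)^t,$$ and such that for every $C^3$-function $\mu:[a,b]\to\mathbb R$, the vector $\tau(\delta)=(\mu(x),\mu(x+\delta/2),\mu(x+\delta))^t$ satisfies, as $\delta\to0^+$, $$\tau(\delta)\cdot v_1(\delta)=\frac{\mathcal R^m_{31}(x)\mu(x)-\mathcal R^m_{32}(x)\mu'(x)+\mathcal R^m_{33}(x)\mu''(x)}{4\sqrt6\,\mathcal R^m_{33}(x)}\,\delta^2+O(\delta^3),$$ $$\tau(\delta)\cdot v_2(\delta)=\frac{R_{1,0}(x)\mu(x)-R_{0,0}(x)\mu'(x)}{\sqrt2\,R_{0,0}(x)}\,\delta+O(\delta^2),\qquad \tau(\delta)\cdot v_3(\delta)=\sqrt3\,\mu(x)+O(\delta).$$ -/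

import Mathlib

open Set Filter Topology MeasureTheory ProbabilityTheory Asymptotics

noncomputable section

namespace CorrSamp

/-- The spatial correlation function
`R(x,y) = 𝔼((u(x) - 𝔼u(x)) (u(y) - 𝔼u(y)))` of a random field `u`. -/
def corr {Ω : Type*} [MeasurableSpace Ω] (P : Measure Ω) (u : ℝ → Ω → ℝ) (x y : ℝ) : ℝ :=
  cov[u x, u y; P]

/-- `R_{k,l}(x) = (∂^{k+l} R / ∂x^k ∂y^l)(x,x)` for a function `R` on `[a,b]²`; at the end points
of `[a,b]` the derivatives are one-sided. -/
def diagDeriv (a b : ℝ) (R : ℝ → ℝ → ℝ) (k l : ℕ) (x : ℝ) : ℝ :=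
  iteratedDerivWithin k (fun s => iteratedDerivWithin l (fun t => R s t) (Icc a b) x) (Icc a b) x

/-- The function `R` on `[a,b]²` is `n` times continuously differentiable in each of its two
variables in a neighborhood of the diagonal: the partial derivatives
`D k l = ∂^{k+l} R / ∂x^k ∂y^l`, `0 ≤ k, l ≤ n`, exist and are continuous on `U ∩ [a,b]²` for some
open set `U` containing the diagonal of `[a,b]²`. -/
def IsSmoothNearDiag (n : ℕ) (a b : ℝ) (R : ℝ → ℝ → ℝ) : Prop :=
  ∃ (U : Set (ℝ × ℝ)) (D : ℕ → ℕ → ℝ → ℝ → ℝ),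
    IsOpen U ∧ (∀ x ∈ Icc a b, (x, x) ∈ U) ∧
    (∀ x ∈ Icc a b, ∀ y ∈ Icc a b, (x, y) ∈ U → D 0 0 x y = R x y) ∧
    (∀ k < n, ∀ l ≤ n, ∀ x ∈ Icc a b, ∀ y ∈ Icc a b, (x, y) ∈ U →
      HasDerivWithinAt (fun s => D k l s y) (D (k + 1) l x y) (Icc a b) x) ∧
    (∀ k ≤ n, ∀ l < n, ∀ x ∈ Icc a b, ∀ y ∈ Icc a b, (x, y) ∈ U →
      HasDerivWithinAt (fun t => D k l x t) (D k (l + 1) x y) (Icc a b) y) ∧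
    (∀ k ≤ n, ∀ l ≤ n,
      ContinuousOn (fun p : ℝ × ℝ => D k l p.1 p.2) (U ∩ Icc a b ×ˢ Icc a b))

/-- The matrix `𝓡(x)` of derivatives of `R` on the diagonal. -/
def corrMatrix (a b : ℝ) (R : ℝ → ℝ → ℝ) (x : ℝ) : Matrix (Fin 3) (Fin 3) ℝ :=
  !![diagDeriv a b R 0 0 x, diagDeriv a b R 1 0 x, diagDeriv a b R 2 0 x;
     diagDeriv a b R 1 0 x, diagDeriv a b R 1 1 x, diagDeriv a b R 2 1 x;
     diagDeriv a b R 2 0 x, diagDeriv a b R 2 1 x, diagDeriv a b R 2 2 x]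

/-- `𝓡^m_{33} = R_{0,0} R_{1,1} - R_{1,0}²`. -/
def minor33 (a b : ℝ) (R : ℝ → ℝ → ℝ) (x : ℝ) : ℝ :=
  diagDeriv a b R 0 0 x * diagDeriv a b R 1 1 x - diagDeriv a b R 1 0 x ^ 2

/-- `𝓡^m_{32} = R_{0,0} R_{2,1} - R_{1,0} R_{2,0}`. -/
def minor32 (a b : ℝ) (R : ℝ → ℝ → ℝ) (x : ℝ) : ℝ :=
  diagDeriv a b R 0 0 x * diagDeriv a b R 2 1 x - diagDeriv a b R 1 0 x * diagDeriv a b R 2 0 x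

/-- `𝓡^m_{31} = R_{1,0} R_{2,1} - R_{1,1} R_{2,0}`. -/
def minor31 (a b : ℝ) (R : ℝ → ℝ → ℝ) (x : ℝ) : ℝ :=
  diagDeriv a b R 1 0 x * diagDeriv a b R 2 1 x - diagDeriv a b R 1 1 x * diagDeriv a b R 2 0 x

/-- Assumption (G1): on `[a,b]`, the random field `u` is Gaussian, centered, and almost surely has
twice continuously differentiable sample paths. Values of `u` off `[a,b]` play no role. -/
structure G1 {Ω : Type*} [MeasurableSpace Ω] (P : Measure Ω) (a b : ℝ) (u : ℝ → Ω → ℝ) :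
    Prop where
  gaussian : IsGaussianProcess (fun t : Icc a b => u t) P
  paths : ∀ᵐ ω ∂P, ContDiffOn ℝ 2 (fun t => u t ω) (Icc a b)
  centered : ∀ t ∈ Icc a b, ∫ ω, u t ω ∂P = 0

/-- Assumption (G2): the spatial correlation function is three times continuously differentiable
(in each variable) near the diagonal, and `𝓡(x)` is positive definite for all `x ∈ [a,b]`. -/
structure G2 {Ω : Type*} [MeasurableSpace Ω] (P : Measure Ω) (a b : ℝ) (u : ℝ → Ω → ℝ) :
    Prop where
  smooth : IsSmoothNearDiag 3 a b (corr P u)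
  posDef : ∀ x ∈ Icc a b, (corrMatrix a b (corr P u) x).PosDef

/-- The vector `(f(x), f(x + δ/2), f(x + δ))`. -/
def sample (f : ℝ → ℝ) (x δ : ℝ) : EuclideanSpace ℝ (Fin 3) :=
  !₂[f x, f (x + δ / 2), f (x + δ)]

/-- The random vector `T(δ) = (u(x), u(x + δ/2), u(x + δ))`. -/
def T {Ω : Type*} (u : ℝ → Ω → ℝ) (x δ : ℝ) (ω : Ω) : EuclideanSpace ℝ (Fin 3) :=
  sample (fun t => u t ω) x δ

/-- The covariance matrix of a random vector in `ℝ³`. -/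
def covMatrix {Ω : Type*} [MeasurableSpace Ω] (P : Measure Ω)
    (X : Ω → EuclideanSpace ℝ (Fin 3)) : Matrix (Fin 3) (Fin 3) ℝ :=
  Matrix.of fun i j => cov[fun ω => X ω i, fun ω => X ω j; P]

theorem covMatrix_isHermitian {Ω : Type*} [MeasurableSpace Ω] (P : Measure Ω)
    (X : Ω → EuclideanSpace ℝ (Fin 3)) : (covMatrix P X).IsHermitian := by
  ext i j
  simp [covMatrix, covariance_comm]

/-- The eigenvalues, counted with multiplicity, of the covariance matrix of a random vector in
`ℝ³`, in increasing order: indices `0, 1, 2` give `λ₁ ≤ λ₂ ≤ λ₃`. (Mathlib's `eigenvalues₀` lists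
them in decreasing order.) -/
def covEigenvalue {Ω : Type*} [MeasurableSpace Ω] (P : Measure Ω)
    (X : Ω → EuclideanSpace ℝ (Fin 3)) (k : Fin 3) : ℝ :=
  (covMatrix_isHermitian P X).eigenvalues₀ (Fin.cast (Fintype.card_fin 3).symm (Fin.rev k))

end CorrSamp

end

/-!
Newton's formula expresses the values at the nodes `x, x + δ/2, x + δ` through divided differences:
with `A = (C(i,k) (δ/2)ᵏ)` and `M(δ)` the matrix of mixed divided differences of the correlation
function, `C(δ) = A M(δ) Aᵀ`, and `M(δ) = 𝓡(x) + O(δ)`. For a unit eigenvector `v` with eigenvalue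
`λ`, put `w = Aᵀ v`. The components of `w` have orders `1, δ, δ²`, and differencing the rows of
`A M(δ) w = λ v` gives three equations for `λ` and `v`, from which a direction with `O(δ)` error
yields the leading terms of `w` and `λ`, and hence of `τ(δ) · v = ∑ₖ wₖ μₖ`, where `μₖ` is the
`k`-th divided difference of `μ`. The directions are found in this order:
* `λ₃ ≥ R₀₀(x) > 0`, so the first and second differences of `v₃` are small;
* the test vector `(1, -2, 1)` shows `λ₁ = O(δ⁴)`, so `w` for `v₁` is nearly orthogonal to the
  first two rows of `𝓡(x)`, that is, nearly parallel to `(𝓡ᵐ₃₁, -𝓡ᵐ₃₂, 𝓡ᵐ₃₃)`; since `𝓡ᵐ₃₃ ≠ 0`,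
  all of `w` is `O(δ²)`, which forces `v₁` towards `(1, -2, 1)`;
* `v₂` is orthogonal to the other two.
-/

noncomputable section

namespace CorrSamp

section Asymptotics

variable {E F : Type*} [NormedAddCommGroup E] [NormedAddCommGroup F] {ι κ : Type*} [Fintype ι]
  {m n : ℕ}

/-- `f(δ) = O(δⁿ)` as `δ → 0⁺`. -/
def IsOrder (n : ℕ) (f : ℝ → E) : Prop :=
  f =O[𝓝[>] 0] fun δ : ℝ => δ ^ n

theorem isOrder_pow (n : ℕ) : IsOrder n fun δ : ℝ => δ ^ n := isBigO_refl _ _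

theorem isOrder_const (c : E) : IsOrder 0 fun _ => c := by
  simpa only [IsOrder, pow_zero] using isBigO_const_one ℝ c _

namespace IsOrder

theorem congr {f g : ℝ → E} (hf : IsOrder n f) (h : ∀ δ > 0, f δ = g δ) : IsOrder n g :=
  IsBigO.congr' hf (eventually_mem_nhdsWithin.mono h) EventuallyEq.rfl

theorem of_norm_le {f : ℝ → E} {K : ℝ} (h : ∀ᶠ δ in 𝓝[>] 0, ‖f δ‖ ≤ K * δ ^ n) : IsOrder n f := by
  refine IsBigO.of_bound K ?_
  filter_upwards [h, self_mem_nhdsWithin] with δ h hδ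
  rwa [Real.norm_of_nonneg (pow_nonneg (mem_Ioi.1 hδ).le n)]

theorem mono {f : ℝ → E} (hf : IsOrder n f) (hmn : m ≤ n) : IsOrder m f := by
  refine hf.trans (IsBigO.of_bound 1 ?_)
  filter_upwards [Ioo_mem_nhdsGT zero_lt_one] with δ hδ
  rw [one_mul, Real.norm_of_nonneg (pow_nonneg hδ.1.le n),
    Real.norm_of_nonneg (pow_nonneg hδ.1.le m)]
  exact pow_le_pow_of_le_one hδ.1.le hδ.2.le hmn

theorem add {f g : ℝ → E} (hf : IsOrder n f) (hg : IsOrder n g) :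
    IsOrder n fun δ => f δ + g δ :=
  IsBigO.add hf hg

theorem sub {f g : ℝ → E} (hf : IsOrder n f) (hg : IsOrder n g) :
    IsOrder n fun δ => f δ - g δ :=
  IsBigO.sub hf hg

theorem mul {f g : ℝ → ℝ} (hf : IsOrder m f) (hg : IsOrder n g) :
    IsOrder (m + n) fun δ => f δ * g δ := by
  simpa only [IsOrder, pow_add] using IsBigO.mul hf hg

theorem const_mul {f : ℝ → ℝ} (hf : IsOrder n f) (c : ℝ) : IsOrder n fun δ => c * f δ :=
  IsBigO.const_mul_left hf c

theorem of_mul {f g : ℝ → ℝ} {c : ℝ} (hc : 0 < c) (hg : ∀ᶠ δ in 𝓝[>] 0, c ≤ |g δ|)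
    (h : IsOrder n fun δ => g δ * f δ) : IsOrder n f := by
  refine (IsBigO.of_bound c⁻¹ (hg.mono fun δ hg => ?_)).trans h
  rw [norm_mul, inv_mul_eq_div, le_div_iff₀' hc]
  exact mul_le_mul_of_nonneg_right hg (norm_nonneg _)

theorem of_pow_mul {f : ℝ → ℝ} (h : IsOrder (m + n) fun δ => δ ^ m * f δ) : IsOrder n f := by
  have h' := (isBigO_refl (fun δ : ℝ => (δ ^ m)⁻¹) (𝓝[>] 0)).mul h
  refine h'.congr' ?_ ?_ <;> filter_upwards [self_mem_nhdsWithin] with δ (hδ : 0 < δ)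
  · rw [inv_mul_cancel_left₀ (by positivity)]
  · rw [pow_add, inv_mul_cancel_left₀ (by positivity)]

theorem dotProduct {f g : ℝ → ι → ℝ} (hf : ∀ i, IsOrder m fun δ => f δ i)
    (hg : ∀ i, IsOrder n fun δ => g δ i) : IsOrder (m + n) fun δ => f δ ⬝ᵥ g δ :=
  (IsBigO.sum fun i (_ : i ∈ Finset.univ) => (hf i).mul (hg i)).congr_left fun δ =>
    Finset.sum_apply δ _ _

theorem of_coord {v : ℝ → EuclideanSpace ℝ ι} (hv : ∀ i, IsOrder n fun δ => v δ i) :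
    IsOrder n v :=
  ((EuclideanSpace.equiv ι ℝ).isBigO_comp_rev v _).trans (isBigO_pi.2 hv)

theorem tendsto_zero {f : ℝ → E} (hf : IsOrder 1 f) : Tendsto f (𝓝[>] 0) (𝓝 0) := by
  refine IsBigO.trans_tendsto hf ?_
  simpa only [pow_one] using! tendsto_nhdsWithin_of_tendsto_nhds tendsto_id

end IsOrder

variable [NormedSpace ℝ E] [NormedSpace ℝ F]

/-- `f(δ) = δⁿ c + O(δⁿ⁺¹)` as `δ → 0⁺`; the coefficient `c` may be zero. -/
def HasLeadingTerm (n : ℕ) (c : E) (f : ℝ → E) : Prop :=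
  IsOrder (n + 1) fun δ => f δ - δ ^ n • c

theorem IsOrder.hasLeadingTerm_zero {f : ℝ → E} (hf : IsOrder (n + 1) f) :
    HasLeadingTerm n 0 f := by
  simpa only [HasLeadingTerm, smul_zero, sub_zero] using hf

theorem hasLeadingTerm_mul_pow (c : ℝ) (n : ℕ) : HasLeadingTerm n c fun δ => c * δ ^ n := by
  simpa only [HasLeadingTerm, IsOrder, smul_eq_mul, mul_comm c, sub_self] using isBigO_zero _ _

namespace HasLeadingTerm

theorem congr {f g : ℝ → E} {c d : E} (hf : HasLeadingTerm n c f) (h : ∀ δ > 0, f δ = g δ)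
    (hcd : c = d) : HasLeadingTerm n d g :=
  hcd ▸ IsOrder.congr hf fun δ hδ => by rw [h δ hδ]

theorem isOrder {f : ℝ → E} {c : E} (hf : HasLeadingTerm n c f) : IsOrder n f := by
  have hc : IsOrder n fun δ : ℝ => δ ^ n • c := by
    simpa only [IsOrder, pow_zero, smul_eq_mul, mul_one] using
      (isOrder_pow n).smul (isOrder_const c)
  exact ((IsOrder.mono hf n.le_succ).add hc).congr_left fun δ => sub_add_cancel _ _

theorem add {f g : ℝ → E} {c d : E} (hf : HasLeadingTerm n c f) (hg : HasLeadingTerm n d g) :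
    HasLeadingTerm n (c + d) fun δ => f δ + g δ :=
  (IsBigO.add hf hg).congr_left fun δ => by rw [smul_add, add_sub_add_comm]

theorem sub {f g : ℝ → E} {c d : E} (hf : HasLeadingTerm n c f) (hg : HasLeadingTerm n d g) :
    HasLeadingTerm n (c - d) fun δ => f δ - g δ :=
  (IsBigO.sub hf hg).congr_left fun δ => by rw [smul_sub, sub_sub_sub_comm]

theorem sum {f : ι → ℝ → E} {c : ι → E} (hf : ∀ i, HasLeadingTerm n (c i) (f i)) :
    HasLeadingTerm n (∑ i, c i) fun δ => ∑ i, f i δ := by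
  refine (IsBigO.sum fun i (_ : i ∈ Finset.univ) => hf i).congr_left fun δ => ?_
  rw [Finset.sum_apply, Finset.sum_sub_distrib, Finset.smul_sum]

theorem mul {f g : ℝ → ℝ} {c d : ℝ} (hf : HasLeadingTerm m c f) (hg : HasLeadingTerm n d g) :
    HasLeadingTerm (m + n) (c * d) fun δ => f δ * g δ := by
  have h₁ := hf.isOrder.mul hg
  have h₂ := (IsOrder.mul hf (isOrder_pow n)).const_mul_left d
  refine IsBigO.congr_left (IsBigO.add (h₁.mono (by omega)) (IsOrder.mono h₂ (by omega))) ?_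
  intro δ
  simp only [smul_eq_mul]
  ring

theorem clm_apply {f : ℝ → E} {c : E} (L : E →L[ℝ] F) (hf : HasLeadingTerm n c f) :
    HasLeadingTerm n (L c) fun δ => L (f δ) :=
  ((L.isBigO_comp _ _).trans hf).congr_left fun δ => by simp

theorem dotProduct {f g : ℝ → ι → ℝ} {c d : ι → ℝ}
    (hf : ∀ i, HasLeadingTerm m (c i) fun δ => f δ i)
    (hg : ∀ i, HasLeadingTerm n (d i) fun δ => g δ i) :
    HasLeadingTerm (m + n) (c ⬝ᵥ d) fun δ => f δ ⬝ᵥ g δ :=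
  sum fun i => (hf i).mul (hg i)

theorem mulVec {M : ℝ → Matrix κ ι ℝ} {N : Matrix κ ι ℝ} {w : ℝ → ι → ℝ} {ω : ι → ℝ}
    (hM : ∀ i j, HasLeadingTerm 0 (N i j) fun δ => M δ i j)
    (hw : ∀ j, HasLeadingTerm n (ω j) fun δ => w δ j) (i : κ) :
    HasLeadingTerm n (N.mulVec ω i) fun δ => (M δ).mulVec (w δ) i := by
  simpa only [zero_add] using! dotProduct (hM i) hw

theorem isOrder_mulVec {M : ℝ → Matrix κ ι ℝ} {N : Matrix κ ι ℝ} {w : ℝ → ι → ℝ}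
    (hM : ∀ i j, HasLeadingTerm 0 (N i j) fun δ => M δ i j)
    (hw : ∀ j, IsOrder n fun δ => w δ j) (i : κ) :
    IsOrder n fun δ => (M δ).mulVec (w δ) i := by
  simpa only [zero_add] using! IsOrder.dotProduct (fun j => (hM i j).isOrder) hw

theorem isBigO {f : ℝ → ℝ} {c : ℝ} (hf : HasLeadingTerm n c f) :
    (fun δ => f δ - c * δ ^ n) =O[𝓝[>] 0] fun δ => δ ^ (n + 1) := by
  simpa only [mul_comm c] using! hf

theorem coord {v : ℝ → EuclideanSpace ℝ ι} {c : EuclideanSpace ℝ ι} (hv : HasLeadingTerm n c v)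
    (i : ι) : HasLeadingTerm n (c i) fun δ => v δ i :=
  hv.clm_apply (EuclideanSpace.proj i)

theorem tendsto {f : ℝ → E} {c : E} (hf : HasLeadingTerm 0 c f) : Tendsto f (𝓝[>] 0) (𝓝 c) := by
  have h : Tendsto (fun δ => f δ - c) (𝓝[>] 0) (𝓝 0) := by
    simpa only [pow_zero, one_smul] using IsOrder.tendsto_zero hf
  simpa only [sub_add_cancel, zero_add] using h.add_const c

theorem isOrder_of_mul {f g : ℝ → ℝ} {c : ℝ} (hg : HasLeadingTerm 0 c g) (hc : c ≠ 0)
    (h : IsOrder n fun δ => g δ * f δ) : IsOrder n f := by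
  have hgc : ∀ᶠ δ in 𝓝[>] 0, |c| / 2 ≤ |g δ| :=
    hg.tendsto.abs.eventually_const_le (half_lt_self (abs_pos.2 hc))
  exact IsOrder.of_mul (half_pos (abs_pos.2 hc)) hgc h

theorem of_mul {f g : ℝ → ℝ} {c d : ℝ} (hg : HasLeadingTerm 0 d g) (hd : d ≠ 0)
    (h : HasLeadingTerm n c fun δ => g δ * f δ) : HasLeadingTerm n (c / d) f := by
  refine hg.isOrder_of_mul hd ?_
  have h' : IsOrder (n + 1) fun δ => (g δ - d) * (c / d * δ ^ n) := by
    have h₁ : IsOrder 1 fun δ => g δ - d := by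
      simpa only [HasLeadingTerm, pow_zero, one_smul] using hg
    simpa only [add_comm n] using h₁.mul ((isOrder_pow n).const_mul_left (c / d))
  refine (IsBigO.sub h h').congr_left fun δ => ?_
  simp only [smul_eq_mul]
  field_simp
  ring

theorem const_mul {f : ℝ → ℝ} {d : ℝ} (hf : HasLeadingTerm n d f) (c : ℝ) :
    HasLeadingTerm n (c * d) fun δ => c * f δ :=
  hf.clm_apply (ContinuousLinearMap.mul ℝ ℝ c)

theorem comp_half {f : ℝ → E} {c : E} (hf : HasLeadingTerm 0 c f) :
    HasLeadingTerm 0 c fun δ => f (δ / 2) := by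
  have hlim : Tendsto (fun δ : ℝ => δ / 2) (𝓝[>] 0) (𝓝[>] 0) :=
    tendsto_nhdsWithin_iff.2 ⟨((continuous_id.div_const 2).tendsto' 0 0 (zero_div 2)).mono_left
      nhdsWithin_le_nhds, eventually_mem_nhdsWithin.mono fun δ (hδ : 0 < δ) => half_pos hδ⟩
  refine IsOrder.congr ((IsBigO.comp_tendsto hf hlim).trans (?_ : IsOrder 1 _)) fun δ _ => ?_
  · exact ((isOrder_pow 1).const_mul 2⁻¹).congr fun δ _ => by
      rw [Function.comp_apply, zero_add, pow_one, pow_one, div_eq_inv_mul]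
  · simp only [Function.comp_apply, pow_zero]

end HasLeadingTerm

theorem hasLeadingTerm_of_norm_eq_one {e : E} (he : e ≠ 0) {v : ℝ → E} {s : ℝ → ℝ}
    (hv : ∀ δ, ‖v δ‖ = 1) (hs : ∀ δ, 0 ≤ s δ) (h : IsOrder 1 fun δ => v δ - s δ • e) :
    HasLeadingTerm 0 (‖e‖⁻¹ • e) v := by
  have he' : 0 < ‖e‖ := norm_pos_iff.2 he
  have hbound (δ : ℝ) : ‖v δ - ‖e‖⁻¹ • e‖ ≤ 2 * ‖v δ - s δ • e‖ := by
    have h₁ : ‖s δ • e - ‖e‖⁻¹ • e‖ ≤ ‖v δ - s δ • e‖ := by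
      have := abs_norm_sub_norm_le (v δ) (s δ • e)
      rw [hv, norm_smul, Real.norm_of_nonneg (hs δ), abs_sub_comm] at this
      rwa [← sub_smul, norm_smul, Real.norm_eq_abs, ← abs_of_pos he', ← abs_mul, sub_mul,
        abs_of_pos he', inv_mul_cancel₀ he'.ne']
    linarith [norm_sub_le_norm_sub_add_norm_sub (v δ) (s δ • e) (‖e‖⁻¹ • e)]
  refine (IsBigO.of_bound 2 (Eventually.of_forall fun δ => ?_)).trans h
  simpa only [pow_zero, one_smul] using hbound δ

theorem isOrder_inner_of_orthogonal {H : Type*} [NormedAddCommGroup H] [InnerProductSpace ℝ H]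
    {e : H} {u v : ℝ → H} (hu : HasLeadingTerm 0 e u) (hv : ∀ δ, ‖v δ‖ = 1)
    (huv : ∀ δ, inner ℝ (u δ) (v δ) = 0) : IsOrder 1 fun δ => inner ℝ e (v δ) := by
  refine (IsBigO.of_bound 1 (Eventually.of_forall fun δ => ?_)).trans hu
  have h := norm_inner_le_norm (𝕜 := ℝ) (u δ - e) (v δ)
  rw [inner_sub_left, huv, zero_sub, norm_neg, hv, mul_one] at h
  simpa only [pow_zero, one_smul, one_mul] using h

end Asymptotics

section DividedDifference

/-- The divided difference of `f` on the equally spaced nodes `x, x + h, …, x + k h`, scaled by `k!`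
so as to approximate `f⁽ᵏ⁾(x)`. -/
def divDiff (k : ℕ) (f : ℝ → ℝ) (x h : ℝ) : ℝ :=
  (fwdDiff h)^[k] f x / h ^ k

/-- The mixed divided difference at `(x, x)`, of order `k` in the first and `l` in the second
variable. -/
def divDiff₂ (k l : ℕ) (R : ℝ → ℝ → ℝ) (x h : ℝ) : ℝ :=
  divDiff k (fun s => divDiff l (R s) x h) x h

/-- The coefficients `C(i,k) hᵏ` of Newton's formula expressing `f(x + i h)` through the divided
differences of `f`. -/
def newtonMatrix (n : ℕ) (h : ℝ) : Matrix (Fin n) (Fin n) ℝ :=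
  Matrix.of fun i k => (i : ℕ).choose k * h ^ (k : ℕ)

theorem divDiff_zero (f : ℝ → ℝ) (x h : ℝ) : divDiff 0 f x h = f x := by
  rw [divDiff, Function.iterate_zero_apply, pow_zero, div_one]

theorem divDiff_eq_sum (k : ℕ) (f : ℝ → ℝ) (x h : ℝ) :
    divDiff k f x h =
      ∑ i ∈ Finset.range (k + 1), (-1) ^ (k - i) * k.choose i / h ^ k * f (x + i * h) := by
  rw [divDiff, fwdDiff_iter_eq_sum_shift, Finset.sum_div]
  refine Finset.sum_congr rfl fun i _ => ?_
  simp only [zsmul_eq_mul, nsmul_eq_mul]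
  push_cast
  ring

theorem divDiff_succ (k : ℕ) (f : ℝ → ℝ) (x h : ℝ) :
    divDiff (k + 1) f x h = divDiff k (fun t => (f (t + h) - f t) / h) x h := by
  have hf : (fun t => (f (t + h) - f t) / h) = h⁻¹ • fwdDiff h f := by
    funext t
    rw [Pi.smul_apply, fwdDiff, smul_eq_mul, inv_mul_eq_div]
  rw [divDiff, divDiff, hf, fwdDiff_iter_const_smul, Function.iterate_succ_apply, Pi.smul_apply,
    smul_eq_mul, inv_mul_eq_div, div_div, pow_succ']

theorem divDiff₂_comm (k l : ℕ) {R : ℝ → ℝ → ℝ} (hR : ∀ s t, R s t = R t s) (x h : ℝ) :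
    divDiff₂ k l R x h = divDiff₂ l k R x h := by
  simp only [divDiff₂, divDiff_eq_sum, Finset.mul_sum]
  rw [Finset.sum_comm]
  refine Finset.sum_congr rfl fun j _ => Finset.sum_congr rfl fun i _ => ?_
  rw [hR, mul_left_comm]

theorem sum_newtonMatrix_mul_divDiff (n : ℕ) (f : ℝ → ℝ) (x : ℝ) {h : ℝ} (hh : h ≠ 0) (i : Fin n) :
    ∑ k : Fin n, newtonMatrix n h i k * divDiff k f x h = f (x + i * h) := by
  have hterm (k : ℕ) :
      (i : ℕ).choose k * h ^ k * divDiff k f x h = (i : ℕ).choose k • (fwdDiff h)^[k] f x := by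
    rw [divDiff, mul_assoc, mul_div_cancel₀ _ (pow_ne_zero k hh), nsmul_eq_mul]
  rw [← nsmul_eq_mul, shift_eq_sum_fwdDiff_iter h f i x]
  simp only [newtonMatrix, Matrix.of_apply, hterm]
  rw [Fin.sum_univ_eq_sum_range fun k => (i : ℕ).choose k • (fwdDiff h)^[k] f x]
  refine (Finset.sum_subset (Finset.range_subset_range.2 i.2) fun k _ hk => ?_).symm
  rw [Nat.choose_eq_zero_of_lt (by simpa using hk), zero_smul]

theorem newtonMatrix_mul_divDiff₂_mul_transpose (n : ℕ) (R : ℝ → ℝ → ℝ) (x : ℝ) {h : ℝ}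
    (hh : h ≠ 0) :
    newtonMatrix n h * Matrix.of (fun k l : Fin n => divDiff₂ k l R x h) *
      (newtonMatrix n h).transpose = Matrix.of fun i j : Fin n => R (x + i * h) (x + j * h) := by
  ext i j
  simp only [Matrix.mul_apply, Matrix.of_apply, Matrix.transpose_apply, divDiff₂,
    sum_newtonMatrix_mul_divDiff n _ x hh]
  simp only [mul_comm (divDiff _ _ _ _), sum_newtonMatrix_mul_divDiff n _ x hh]

theorem det_newtonMatrix_ne_zero (n : ℕ) {h : ℝ} (hh : h ≠ 0) : (newtonMatrix n h).det ≠ 0 := by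
  rw [Matrix.det_of_isLowerTriangular]
  · refine Finset.prod_ne_zero_iff.2 fun i _ => ?_
    rw [newtonMatrix, Matrix.of_apply, Nat.choose_self, Nat.cast_one, one_mul]
    exact pow_ne_zero _ hh
  · intro i k hik
    rw [newtonMatrix, Matrix.of_apply, Nat.choose_eq_zero_of_lt (by simpa using hik), Nat.cast_zero,
      zero_mul]

section MeanValue

variable {x h : ℝ} {k l : ℕ}

theorem nodes_mem_Icc (hh : 0 ≤ h) {i : ℕ} (hi : i ≤ k) : x + i * h ∈ Icc x (x + k * h) := by
  refine ⟨le_add_of_nonneg_right (by positivity), ?_⟩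
  gcongr

theorem divDiff_congr {f g : ℝ → ℝ} (hh : 0 ≤ h) (hfg : ∀ t ∈ Icc x (x + k * h), f t = g t) :
    divDiff k f x h = divDiff k g x h := by
  simp only [divDiff_eq_sum]
  refine Finset.sum_congr rfl fun i hi => ?_
  rw [hfg _ (nodes_mem_Icc hh (Finset.mem_range_succ_iff.1 hi))]

theorem hasDerivWithinAt_divDiff {H : ℝ → ℝ → ℝ} {H' : ℝ → ℝ} {S : Set ℝ} {s : ℝ} (hh : 0 ≤ h)
    (hH : ∀ t ∈ Icc x (x + k * h), HasDerivWithinAt (fun s => H s t) (H' t) S s) :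
    HasDerivWithinAt (fun s => divDiff k (H s) x h) (divDiff k H' x h) S s := by
  simp only [divDiff_eq_sum]
  exact HasDerivWithinAt.fun_sum fun i hi =>
    (hH _ (nodes_mem_Icc hh (Finset.mem_range_succ_iff.1 hi))).const_mul _

theorem exists_slope_eq_of_hasDerivWithinAt {f f' : ℝ → ℝ} {c d : ℝ} (hcd : c < d)
    (hf : ∀ t ∈ Icc c d, HasDerivWithinAt f (f' t) (Icc c d) t) :
    ∃ ξ ∈ Icc c d, (f d - f c) / (d - c) = f' ξ := by
  obtain ⟨ξ, hξ, h'⟩ := exists_hasDerivAt_eq_slope f f' hcd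
    (fun t ht => (hf t ht).continuousWithinAt)
    fun t ht => (hf t (Ioo_subset_Icc_self ht)).hasDerivAt (Icc_mem_nhds ht.1 ht.2)
  exact ⟨ξ, Ioo_subset_Icc_self hξ, h'.symm⟩

theorem exists_divDiff_eq {F : ℕ → ℝ → ℝ} (hh : 0 < h)
    (hF : ∀ j < k, ∀ t ∈ Icc x (x + k * h),
      HasDerivWithinAt (F j) (F (j + 1) t) (Icc x (x + k * h)) t) :
    ∃ ξ ∈ Icc x (x + k * h), divDiff k (F 0) x h = F k ξ := by
  induction k generalizing F with
  | zero => exact ⟨x, by simp, divDiff_zero _ _ _⟩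
  | succ k ih =>
    have hend : x + k * h + h = x + (k + 1 : ℕ) * h := by push_cast; ring
    rw [← hend] at hF ⊢
    have hshift : MapsTo (· + h) (Icc x (x + k * h)) (Icc x (x + k * h + h)) := fun t ht =>
      ⟨by linarith [ht.1], by linarith [ht.2]⟩
    have hsub : Icc x (x + k * h) ⊆ Icc x (x + k * h + h) := Icc_subset_Icc_right (by linarith)
    obtain ⟨ξ, hξ, hξ'⟩ := ih (F := fun j t => (F j (t + h) - F j t) / h) fun j hj t ht => by
      have h₁ := (hF j (by omega) (t + h) (hshift ht)).comp t
        ((hasDerivWithinAt_id t _).add_const h) hshift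
      rw [mul_one] at h₁
      exact (h₁.sub ((hF j (by omega) t (hsub ht)).mono hsub)).div_const h
    have hsub' : Icc ξ (ξ + h) ⊆ Icc x (x + k * h + h) :=
      Icc_subset_Icc hξ.1 (by linarith [hξ.2])
    obtain ⟨η, hη, hη'⟩ := exists_slope_eq_of_hasDerivWithinAt (lt_add_of_pos_right ξ hh)
      fun t ht => (hF k k.lt_succ_self t (hsub' ht)).mono hsub'
    refine ⟨η, hsub' hη, ?_⟩
    rw [divDiff_succ, hξ', ← hη', add_sub_cancel_left]

end MeanValue

section Approximation

variable {a b c d x : ℝ} {n k l : ℕ} {R : ℝ → ℝ → ℝ} {D : ℕ → ℕ → ℝ → ℝ → ℝ}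

theorem iteratedDerivWithin_eq_of_hasDerivWithinAt {F : ℕ → ℝ → ℝ} {S : Set ℝ}
    (hS : UniqueDiffOn ℝ S) (hF : ∀ j < n, ∀ t ∈ S, HasDerivWithinAt (F j) (F (j + 1) t) S t)
    {t : ℝ} (ht : t ∈ S) : iteratedDerivWithin n (F 0) S t = F n t := by
  induction n generalizing t with
  | zero => rw [iteratedDerivWithin_zero]
  | succ n ih =>
    have ih' : EqOn (iteratedDerivWithin n (F 0) S) (F n) S := fun s hs =>
      ih (fun j hj => hF j (by omega)) hs
    rw [iteratedDerivWithin_succ, derivWithin_congr ih' (ih' ht),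
      (hF n n.lt_succ_self t ht).derivWithin (hS t ht)]

theorem eventually_add_mul_le (hx : x < b) (r : ℝ) : ∀ᶠ h in 𝓝[>] 0, x + r * h ≤ b := by
  have hlim : Tendsto (fun h => x + r * h) (𝓝 0) (𝓝 x) :=
    (by fun_prop : Continuous fun h => x + r * h).tendsto' 0 x (by simp)
  exact (hlim.mono_left nhdsWithin_le_nhds).eventually_le_const hx

theorem hasLeadingTerm_divDiff (hx : x ∈ Ico a b) {μ : ℝ → ℝ}
    (hμ : ContDiffOn ℝ (k + 1) μ (Icc a b)) :
    HasLeadingTerm 0 (iteratedDerivWithin k μ (Icc a b) x) (divDiff k μ x) := by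
  have hu : UniqueDiffOn ℝ (Icc a b) := uniqueDiffOn_Icc (hx.1.trans_lt hx.2)
  have hd : ∀ j < k + 1, ∀ t ∈ Icc a b, HasDerivWithinAt (iteratedDerivWithin j μ (Icc a b))
      (iteratedDerivWithin (j + 1) μ (Icc a b) t) (Icc a b) t := fun j hj t ht => by
    rw [iteratedDerivWithin_succ]
    exact (hμ.differentiableOn_iteratedDerivWithin (by exact_mod_cast hj) hu t ht).hasDerivWithinAt
  obtain ⟨K, hK⟩ := isCompact_Icc.exists_bound_of_continuousOn
    (hμ.continuousOn_iteratedDerivWithin (m := k + 1) (by exact_mod_cast le_rfl) hu)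
  refine IsOrder.of_norm_le (K := K * k) ?_
  filter_upwards [self_mem_nhdsWithin, eventually_add_mul_le hx.2 k] with h (hh : 0 < h) hb
  have hs : Icc x (x + k * h) ⊆ Icc a b := Icc_subset_Icc hx.1 hb
  obtain ⟨ξ, hξ, hξ'⟩ := exists_divDiff_eq (F := fun j => iteratedDerivWithin j μ (Icc a b)) hh
    fun j hj t ht => (hd j (by omega) t (hs ht)).mono hs
  rw [iteratedDerivWithin_zero] at hξ'
  rw [hξ', pow_zero, one_smul, zero_add, pow_one, mul_assoc]
  exact ((convex_Icc a b).norm_image_sub_le_of_norm_hasDerivWithin_le (hd k k.lt_succ_self) hK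
    (Ico_subset_Icc_self hx) (hs hξ)).trans <| mul_le_mul_of_nonneg_left
      (by rw [Real.norm_of_nonneg (sub_nonneg.2 hξ.1)]; linarith [hξ.2])
      ((norm_nonneg _).trans (hK x (Ico_subset_Icc_self hx)))

/-- The functions `D k l`, `k, l ≤ n`, are continuous mixed partial derivatives
`∂^{k+l} R / ∂s^k ∂t^l` of `R` on the square `S × S`. -/
structure HasPartialDerivsOn (n : ℕ) (S : Set ℝ) (R : ℝ → ℝ → ℝ) (D : ℕ → ℕ → ℝ → ℝ → ℝ) :
    Prop where
  zero_zero : ∀ s ∈ S, ∀ t ∈ S, R s t = D 0 0 s t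
  left : ∀ k < n, ∀ l ≤ n, ∀ s ∈ S, ∀ t ∈ S,
    HasDerivWithinAt (fun s => D k l s t) (D (k + 1) l s t) S s
  right : ∀ k ≤ n, ∀ l < n, ∀ s ∈ S, ∀ t ∈ S,
    HasDerivWithinAt (fun t => D k l s t) (D k (l + 1) s t) S t
  continuousOn : ∀ k ≤ n, ∀ l ≤ n, ContinuousOn (fun p : ℝ × ℝ => D k l p.1 p.2) (S ×ˢ S)

theorem diagDeriv_eq_of_inter {V : Set ℝ} (hV : V ∈ 𝓝 x) (h : Icc c d = Icc a b ∩ V) :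
    diagDeriv c d R k l x = diagDeriv a b R k l x := by
  simp only [diagDeriv, iteratedDerivWithin, h, iteratedFDerivWithin_inter hV]

theorem exists_hasPartialDerivsOn (hx : x ∈ Ico a b) (hR : IsSmoothNearDiag n a b R) :
    ∃ c d D, x ∈ Ico c d ∧ HasPartialDerivsOn n (Icc c d) R D ∧
      ∀ k l, diagDeriv c d R k l x = diagDeriv a b R k l x := by
  obtain ⟨U, D, hUo, hUd, hzero, hleft, hright, hcont⟩ := hR
  obtain ⟨ρ, hρ, hρU⟩ := Metric.nhds_basis_closedBall.mem_iff.1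
    (hUo.mem_nhds (hUd x (Ico_subset_Icc_self hx)))
  rw [← closedBall_prod_same, Real.closedBall_eq_Icc] at hρU
  have hcd : Icc (max a (x - ρ)) (min b (x + ρ)) = Icc a b ∩ Icc (x - ρ) (x + ρ) :=
    Icc_inter_Icc.symm
  have hab : Icc (max a (x - ρ)) (min b (x + ρ)) ⊆ Icc a b := hcd ▸ inter_subset_left
  have hU : ∀ s ∈ Icc (max a (x - ρ)) (min b (x + ρ)),
      ∀ t ∈ Icc (max a (x - ρ)) (min b (x + ρ)), (s, t) ∈ U := fun s hs t ht =>
    hρU ⟨(hcd ▸ hs).2, (hcd ▸ ht).2⟩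
  refine ⟨_, _, D, ⟨max_le hx.1 (by linarith), lt_min hx.2 (by linarith)⟩, ⟨?_, ?_, ?_, ?_⟩,
    fun k l => diagDeriv_eq_of_inter (Icc_mem_nhds (by linarith) (by linarith)) hcd⟩
  · exact fun s hs t ht => (hzero s (hab hs) t (hab ht) (hU s hs t ht)).symm
  · exact fun k hk l hl s hs t ht => (hleft k hk l hl s (hab hs) t (hab ht) (hU s hs t ht)).mono hab
  · exact fun k hk l hl s hs t ht =>
      (hright k hk l hl s (hab hs) t (hab ht) (hU s hs t ht)).mono hab
  · exact fun k hk l hl => (hcont k hk l hl).mono fun p hp =>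
      ⟨hU _ hp.1 _ hp.2, hab hp.1, hab hp.2⟩

namespace HasPartialDerivsOn

theorem diagDeriv_eq (hD : HasPartialDerivsOn n (Icc c d) R D) (hx : x ∈ Ico c d) (hk : k ≤ n)
    (hl : l ≤ n) : diagDeriv c d R k l x = D k l x x := by
  have hu : UniqueDiffOn ℝ (Icc c d) := uniqueDiffOn_Icc (hx.1.trans_lt hx.2)
  have hx' : x ∈ Icc c d := Ico_subset_Icc_self hx
  have hinner : EqOn (fun s => iteratedDerivWithin l (R s) (Icc c d) x) (fun s => D 0 l s x)
      (Icc c d) := fun s hs => by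
    dsimp only
    rw [iteratedDerivWithin_congr (hD.zero_zero s hs) hx']
    exact iteratedDerivWithin_eq_of_hasDerivWithinAt (F := fun l t => D 0 l s t) hu
      (fun j hj => hD.right 0 (Nat.zero_le n) j (by omega) s hs) hx'
  rw [diagDeriv, iteratedDerivWithin_congr hinner hx']
  exact iteratedDerivWithin_eq_of_hasDerivWithinAt (F := fun k s => D k l s x) hu
    (fun j hj s hs => hD.left j (by omega) l hl s hs x hx') hx'

theorem exists_divDiff₂_eq {S : Set ℝ} (hD : HasPartialDerivsOn n S R D) {h : ℝ} (hh : 0 < h)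
    (hS : Icc x (x + n * h) ⊆ S) (hk : k ≤ n) (hl : l ≤ n) :
    ∃ ξ ∈ Icc x (x + n * h), ∃ η ∈ Icc x (x + n * h), divDiff₂ k l R x h = D k l ξ η := by
  have hsub {m : ℕ} (hm : m ≤ n) : Icc x (x + m * h) ⊆ Icc x (x + n * h) :=
    Icc_subset_Icc_right (by gcongr)
  have hS' {m : ℕ} (hm : m ≤ n) : Icc x (x + m * h) ⊆ S := (hsub hm).trans hS
  have hzero : divDiff₂ k l R x h = divDiff k (fun s => divDiff l (D 0 0 s) x h) x h :=
    divDiff_congr hh.le fun s hs => divDiff_congr hh.le fun t ht =>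
      hD.zero_zero s (hS' hk hs) t (hS' hl ht)
  obtain ⟨ξ, hξ, hξ'⟩ := exists_divDiff_eq (F := fun j s => divDiff l (D j 0 s) x h) hh
    fun j hj s hs => hasDerivWithinAt_divDiff hh.le fun t ht =>
      (hD.left j (by omega) 0 (Nat.zero_le n) s (hS' hk hs) t (hS' hl ht)).mono (hS' hk)
  obtain ⟨η, hη, hη'⟩ := exists_divDiff_eq (F := fun j t => D k j ξ t) hh
    fun j hj t ht => (hD.right k hk j (by omega) ξ (hS' hk hξ) t (hS' hl ht)).mono (hS' hl)
  exact ⟨ξ, hsub hk hξ, η, hsub hl hη, hzero.trans (hξ'.trans hη')⟩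

theorem exists_norm_sub_le (hD : HasPartialDerivsOn n (Icc c d) R D) (hk : k < n) (hl : l < n) :
    ∃ K ≥ 0, ∀ x ∈ Icc c d, ∀ ξ ∈ Icc c d, ∀ η ∈ Icc c d,
      ‖D k l ξ η - D k l x x‖ ≤ K * (|ξ - x| + |η - x|) := by
  obtain ⟨K₁, hK₁⟩ := (isCompact_Icc.prod isCompact_Icc).exists_bound_of_continuousOn
    (hD.continuousOn (k + 1) hk l hl.le)
  obtain ⟨K₂, hK₂⟩ := (isCompact_Icc.prod isCompact_Icc).exists_bound_of_continuousOn
    (hD.continuousOn k hk.le (l + 1) hl)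
  refine ⟨max 0 (max K₁ K₂), le_max_left _ _, fun x hx ξ hξ η hη => ?_⟩
  have hleft : ‖D k l ξ η - D k l x η‖ ≤ max 0 (max K₁ K₂) * |ξ - x| :=
    (convex_Icc c d).norm_image_sub_le_of_norm_hasDerivWithin_le (f := fun s => D k l s η)
      (fun s hs => hD.left k hk l hl.le s hs η hη)
      (fun s hs => (hK₁ (s, η) ⟨hs, hη⟩).trans (by simp)) hx hξ
  have hright : ‖D k l x η - D k l x x‖ ≤ max 0 (max K₁ K₂) * |η - x| :=
    (convex_Icc c d).norm_image_sub_le_of_norm_hasDerivWithin_le (f := fun t => D k l x t)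
      (fun t ht => hD.right k hk.le l hl x hx t ht)
      (fun t ht => (hK₂ (x, t) ⟨hx, ht⟩).trans (by simp)) hx hη
  linarith [norm_sub_le_norm_sub_add_norm_sub (D k l ξ η) (D k l x η) (D k l x x)]

end HasPartialDerivsOn

theorem hasLeadingTerm_divDiff₂ (hx : x ∈ Ico a b) (hR : IsSmoothNearDiag n a b R) (hk : k < n)
    (hl : l < n) : HasLeadingTerm 0 (diagDeriv a b R k l x) (divDiff₂ k l R x) := by
  obtain ⟨c, d, D, hxcd, hD, hdiag⟩ := exists_hasPartialDerivsOn hx hR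
  obtain ⟨K, hK, hKD⟩ := hD.exists_norm_sub_le hk hl
  rw [← hdiag, hD.diagDeriv_eq hxcd hk.le hl.le]
  refine IsOrder.of_norm_le (K := K * (2 * n)) ?_
  filter_upwards [self_mem_nhdsWithin, eventually_add_mul_le hxcd.2 n] with h (hh : 0 < h) hd
  have hs : Icc x (x + n * h) ⊆ Icc c d := Icc_subset_Icc hxcd.1 hd
  obtain ⟨ξ, hξ, η, hη, hξη⟩ := hD.exists_divDiff₂_eq hh hs hk.le hl.le
  rw [hξη, pow_zero, one_smul, zero_add, pow_one, mul_assoc]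
  refine (hKD x (Ico_subset_Icc_self hxcd) ξ (hs hξ) η (hs hη)).trans
    (mul_le_mul_of_nonneg_left ?_ hK)
  rw [abs_of_nonneg (sub_nonneg.2 hξ.1), abs_of_nonneg (sub_nonneg.2 hη.1)]
  linarith [hξ.2, hη.2]

theorem diagDeriv_comm (hx : x ∈ Ico a b) (hR : IsSmoothNearDiag n a b R)
    (hsymm : ∀ s t, R s t = R t s) (hk : k < n) (hl : l < n) :
    diagDeriv a b R k l x = diagDeriv a b R l k x := by
  refine tendsto_nhds_unique (hasLeadingTerm_divDiff₂ hx hR hk hl).tendsto ?_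
  exact (hasLeadingTerm_divDiff₂ hx hR hl hk).tendsto.congr fun h => divDiff₂_comm l k hsymm x h

end Approximation

end DividedDifference

section Eigenpair

open Matrix

/-- The coefficients of the divided differences of `μ`, of step `δ/2`, in the inner product of
`(μ(x), μ(x + δ/2), μ(x + δ))` with `v(δ)`. -/
def newtonMoments (v : ℝ → EuclideanSpace ℝ (Fin 3)) (δ : ℝ) : Fin 3 → ℝ :=
  (newtonMatrix 3 (δ / 2))ᵀ *ᵥ v δ

/-- `v(δ)` is a unit eigenvector, with eigenvalue `l(δ)`, of the matrix `A M(δ) Aᵀ`, where `A` is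
Newton's matrix of step `δ/2`. -/
structure IsNewtonEigenpair (M : ℝ → Matrix (Fin 3) (Fin 3) ℝ) (l : ℝ → ℝ)
    (v : ℝ → EuclideanSpace ℝ (Fin 3)) : Prop where
  norm_eq_one : ∀ δ, ‖v δ‖ = 1
  eigen : ∀ δ > 0,
    (newtonMatrix 3 (δ / 2) * M δ * (newtonMatrix 3 (δ / 2))ᵀ) *ᵥ v δ = l δ • (v δ).ofLp

theorem newtonMatrix_three (h : ℝ) :
    newtonMatrix 3 h = !![1, 0, 0; 1, h, 0; 1, 2 * h, h ^ 2] := by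
  ext i k
  fin_cases i <;> fin_cases k <;> simp [newtonMatrix]

theorem newtonMoments_eq (v : ℝ → EuclideanSpace ℝ (Fin 3)) (δ : ℝ) : newtonMoments v δ =
    ![v δ 0 + v δ 1 + v δ 2, δ * ((v δ 1 + 2 * v δ 2) / 2), δ ^ 2 * (v δ 2 / 4)] := by
  ext k
  rw [newtonMoments, newtonMatrix_three, mulVec, vec3_dotProduct]
  match k with
  | 0 | 1 | 2 => simp only [transpose_apply, of_apply, cons_val]; ring

theorem hasLeadingTerm_newtonMoments {v : ℝ → EuclideanSpace ℝ (Fin 3)}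
    {e : EuclideanSpace ℝ (Fin 3)} (hv : HasLeadingTerm 0 e v) (k : Fin 3) :
    HasLeadingTerm k (newtonMoments (fun _ => e) 1 k) fun δ => newtonMoments v δ k := by
  refine HasLeadingTerm.dotProduct (n := 0) (fun i => ?_) hv.coord
  refine (hasLeadingTerm_mul_pow ((newtonMatrix 3 (1 / 2))ᵀ k i) k).congr (fun δ _ => ?_) rfl
  simp only [newtonMatrix, transpose_apply, of_apply]
  ring

theorem norm_one_one_one : ‖(!₂[1, 1, 1] : EuclideanSpace ℝ (Fin 3))‖ = √3 := by
  rw [EuclideanSpace.norm_eq]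
  norm_num [Fin.sum_univ_succ]

theorem norm_one_neg_two_one : ‖(!₂[1, -2, 1] : EuclideanSpace ℝ (Fin 3))‖ = √6 := by
  rw [EuclideanSpace.norm_eq]
  norm_num [Fin.sum_univ_succ]

theorem norm_one_zero_neg_one : ‖(!₂[1, 0, -1] : EuclideanSpace ℝ (Fin 3))‖ = √2 := by
  rw [EuclideanSpace.norm_eq]
  norm_num [Fin.sum_univ_succ]

namespace IsNewtonEigenpair

variable {M : ℝ → Matrix (Fin 3) (Fin 3) ℝ} {N : Matrix (Fin 3) (Fin 3) ℝ} {l : ℝ → ℝ}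
  {v : ℝ → EuclideanSpace ℝ (Fin 3)}

theorem isOrder_coord (h : IsNewtonEigenpair M l v) (i : Fin 3) : IsOrder 0 fun δ => v δ i := by
  refine IsOrder.of_norm_le (K := 1) (Eventually.of_forall fun δ => ?_)
  simpa only [pow_zero, mul_one, h.norm_eq_one] using PiLp.norm_apply_le (v δ) i

theorem isOrder_moments (h : IsNewtonEigenpair M l v) (k : Fin 3) :
    IsOrder k fun δ => newtonMoments v δ k := by
  have hA (i : Fin 3) : IsOrder k fun δ => newtonMatrix 3 (δ / 2) i k :=
    ((isOrder_pow k).const_mul ((i : ℕ).choose k / 2 ^ (k : ℕ))).congr_left fun δ => by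
      rw [newtonMatrix, of_apply, div_pow, div_mul_eq_mul_div, mul_div_assoc]
  exact IsOrder.dotProduct hA h.isOrder_coord

theorem newtonMatrix_mulVec (h : IsNewtonEigenpair M l v) {δ : ℝ} (hδ : 0 < δ) :
    newtonMatrix 3 (δ / 2) *ᵥ (M δ *ᵥ newtonMoments v δ) = l δ • (v δ).ofLp := by
  simpa only [newtonMoments, mulVec_mulVec, mul_assoc] using h.eigen δ hδ

theorem row_zero (h : IsNewtonEigenpair M l v) {δ : ℝ} (hδ : 0 < δ) :
    (M δ *ᵥ newtonMoments v δ) 0 = l δ * v δ 0 := by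
  have h₀ := congrFun (h.newtonMatrix_mulVec hδ) 0
  rw [newtonMatrix_three, mulVec, vec3_dotProduct] at h₀
  simp only [of_apply, cons_val, Pi.smul_apply, smul_eq_mul] at h₀
  linear_combination h₀

theorem row_one (h : IsNewtonEigenpair M l v) {δ : ℝ} (hδ : 0 < δ) :
    δ * (M δ *ᵥ newtonMoments v δ) 1 = 2 * (l δ * (v δ 1 - v δ 0)) := by
  have h₁ := congrFun (h.newtonMatrix_mulVec hδ) 1
  rw [newtonMatrix_three, mulVec, vec3_dotProduct] at h₁
  simp only [of_apply, cons_val, Pi.smul_apply, smul_eq_mul] at h₁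
  linear_combination 2 * h₁ - 2 * h.row_zero hδ

theorem row_two (h : IsNewtonEigenpair M l v) {δ : ℝ} (hδ : 0 < δ) :
    δ ^ 2 * (M δ *ᵥ newtonMoments v δ) 2 = 4 * (l δ * (v δ 0 - 2 * v δ 1 + v δ 2)) := by
  have h₂ := congrFun (h.newtonMatrix_mulVec hδ) 2
  rw [newtonMatrix_three, mulVec, vec3_dotProduct] at h₂
  simp only [of_apply, cons_val, Pi.smul_apply, smul_eq_mul] at h₂
  linear_combination 4 * h₂ - 4 * h.row_zero hδ - 4 * h.row_one hδ

theorem dotProduct_mulVec_moments (h : IsNewtonEigenpair M l v) {δ : ℝ} (hδ : 0 < δ) :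
    newtonMoments v δ ⬝ᵥ (M δ *ᵥ newtonMoments v δ) = l δ := by
  have hn : (v δ).ofLp ⬝ᵥ (v δ).ofLp = 1 := by
    rw [← star_trivial (v δ).ofLp, ← EuclideanSpace.inner_eq_star_dotProduct]
    simp [h.norm_eq_one]
  calc newtonMoments v δ ⬝ᵥ (M δ *ᵥ newtonMoments v δ)
      = (v δ).ofLp ⬝ᵥ (newtonMatrix 3 (δ / 2) *ᵥ (M δ *ᵥ newtonMoments v δ)) := by
        rw [dotProduct_mulVec _ (newtonMatrix 3 (δ / 2)), ← mulVec_transpose, newtonMoments]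
    _ = l δ := by rw [h.newtonMatrix_mulVec hδ, dotProduct_smul, hn, smul_eq_mul, mul_one]

section Largest

theorem direction_of_eigenvalue_ge (h : IsNewtonEigenpair M l v)
    (hM : ∀ i j, HasLeadingTerm 0 (N i j) fun δ => M δ i j) {c : ℝ} (hc : 0 < c)
    (hl : ∀ᶠ δ in 𝓝[>] 0, c ≤ l δ) (hv : ∀ δ, 0 ≤ v δ 2) :
    HasLeadingTerm 0 ((1 / √3) • !₂[1, 1, 1]) v := by
  have hl' : ∀ᶠ δ in 𝓝[>] 0, c ≤ |l δ| := hl.mono fun δ h => h.trans (le_abs_self _)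
  have hMw := HasLeadingTerm.isOrder_mulVec hM fun k => (h.isOrder_moments k).mono (Nat.zero_le _)
  have h₁ : IsOrder 1 fun δ => v δ 1 - v δ 0 := by
    refine IsOrder.of_mul hc hl' <|
      (((isOrder_pow 1).mul (hMw 1)).const_mul (1 / 2)).congr fun δ hδ => ?_
    linear_combination 1 / 2 * h.row_one hδ
  have h₂ : IsOrder 2 fun δ => v δ 0 - 2 * v δ 1 + v δ 2 := by
    refine IsOrder.of_mul hc hl' <|
      (((isOrder_pow 2).mul (hMw 2)).const_mul (1 / 4)).congr fun δ hδ => ?_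
    linear_combination 1 / 4 * h.row_two hδ
  have h₃ : IsOrder 1 fun δ => v δ - v δ 2 • !₂[1, 1, 1] := by
    refine IsOrder.of_coord fun i => ?_
    match i with
    | 0 =>
      refine ((h₁.const_mul (-2)).sub (h₂.mono one_le_two)).congr fun δ _ => ?_
      simp only [PiLp.sub_apply, PiLp.smul_apply, smul_eq_mul, cons_val]
      ring
    | 1 =>
      refine ((h₁.const_mul (-1)).sub (h₂.mono one_le_two)).congr fun δ _ => ?_
      simp only [PiLp.sub_apply, PiLp.smul_apply, smul_eq_mul, cons_val]
      ring
    | 2 =>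
      refine (isBigO_zero _ _).congr_left fun δ => ?_
      simp only [PiLp.sub_apply, PiLp.smul_apply, smul_eq_mul, cons_val]
      ring
  simpa only [norm_one_one_one, one_div] using
    hasLeadingTerm_of_norm_eq_one (by simp) h.norm_eq_one hv h₃

theorem moments_of_direction_one_one_one (hv : HasLeadingTerm 0 ((1 / √3) • !₂[1, 1, 1]) v)
    (k : Fin 3) : HasLeadingTerm 0 (![√3, 0, 0] k) fun δ => newtonMoments v δ k := by
  have hw := hasLeadingTerm_newtonMoments hv
  match k with
  | 0 =>
    refine (hw 0).congr (fun _ _ => rfl) ?_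
    rw [newtonMoments_eq]
    simp only [PiLp.smul_apply, smul_eq_mul, cons_val]
    field_simp
    norm_num
  | 1 => exact (hw 1).isOrder.hasLeadingTerm_zero
  | 2 => exact ((hw 2).isOrder.mono one_le_two).hasLeadingTerm_zero

theorem eigenvalue_of_direction_one_one_one (h : IsNewtonEigenpair M l v)
    (hM : ∀ i j, HasLeadingTerm 0 (N i j) fun δ => M δ i j)
    (hv : HasLeadingTerm 0 ((1 / √3) • !₂[1, 1, 1]) v) : HasLeadingTerm 0 (3 * N 0 0) l := by
  have hp : HasLeadingTerm 0 (1 / √3) fun δ => v δ 0 := by simpa using hv.coord 0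
  have hMw := HasLeadingTerm.mulVec hM (moments_of_direction_one_one_one hv) 0
  refine (HasLeadingTerm.of_mul hp (by positivity) (hMw.congr (fun δ hδ => ?_) rfl)).congr
    (fun _ _ => rfl) ?_
  · rw [h.row_zero hδ, mul_comm]
  · rw [mulVec, vec3_dotProduct]
    simp only [cons_val]
    field_simp
    linear_combination N 0 0 * Real.mul_self_sqrt (zero_le_three (α := ℝ))

end Largest

section Smallest

theorem hasLeadingTerm_cross (hM : ∀ i j, HasLeadingTerm 0 (N i j) fun δ => M δ i j) (k : Fin 3) :
    HasLeadingTerm 0 ((N 0 ⨯₃ N 1) k) fun δ => (M δ 0 ⨯₃ M δ 1) k := by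
  simp only [cross_apply]
  match k with
  | 0 | 1 | 2 => exact ((hM 0 _).mul (hM 1 _)).sub ((hM 0 _).mul (hM 1 _))

/-- The first two rows of the eigen-equation say that the moments are nearly orthogonal to the first
two rows of `M`, hence nearly parallel to their cross product. -/
theorem isOrder_moments_sub_cross (h : IsNewtonEigenpair M l v)
    (hM : ∀ i j, HasLeadingTerm 0 (N i j) fun δ => M δ i j) (hl : IsOrder 4 l) (k : Fin 3) :
    IsOrder 3 fun δ => (M δ 0 ⨯₃ M δ 1) 2 * newtonMoments v δ k -
      (M δ 0 ⨯₃ M δ 1) k * newtonMoments v δ 2 := by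
  have h₀ : IsOrder 3 fun δ => M δ 0 ⬝ᵥ newtonMoments v δ :=
    ((hl.mul (h.isOrder_coord 0)).mono (by norm_num)).congr fun δ hδ => (h.row_zero hδ).symm
  have h₁ : IsOrder 3 fun δ => M δ 1 ⬝ᵥ newtonMoments v δ :=
    IsOrder.of_pow_mul (m := 1) <| ((hl.mul ((h.isOrder_coord 1).sub (h.isOrder_coord 0))).const_mul
      2).congr fun δ hδ => by rw [pow_one, ← h.row_one hδ, mulVec]
  have hM' (i j : Fin 3) : IsOrder 0 fun δ => M δ i j := (hM i j).isOrder
  simp only [cross_apply]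
  match k with
  | 0 =>
    refine (((hM' 1 1).mul h₀).sub ((hM' 0 1).mul h₁)).congr fun δ _ => ?_
    rw [vec3_dotProduct, vec3_dotProduct]
    simp only [cons_val]
    ring
  | 1 =>
    refine (((hM' 0 0).mul h₁).sub ((hM' 1 0).mul h₀)).congr fun δ _ => ?_
    rw [vec3_dotProduct, vec3_dotProduct]
    simp only [cons_val]
    ring
  | 2 =>
    refine (isBigO_zero _ _).congr_left fun δ => ?_
    ring

theorem direction_of_isOrder_four (h : IsNewtonEigenpair M l v)
    (hM : ∀ i j, HasLeadingTerm 0 (N i j) fun δ => M δ i j) (hl : IsOrder 4 l)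
    (hc : (N 0 ⨯₃ N 1) 2 ≠ 0) (hv : ∀ δ, 0 ≤ v δ 2) :
    HasLeadingTerm 0 ((1 / √6) • !₂[1, -2, 1]) v := by
  have hc' := hasLeadingTerm_cross hM
  have hw (k : Fin 3) : IsOrder 2 fun δ => newtonMoments v δ k := by
    refine (hc' 2).isOrder_of_mul hc <|
      (((h.isOrder_moments_sub_cross hM hl k).mono (Nat.le_succ 2)).add
        ((hc' k).isOrder.mul (h.isOrder_moments 2))).congr fun δ _ => ?_
    exact sub_add_cancel _ _
  have h₀ : IsOrder 1 fun δ => v δ 0 + v δ 1 + v δ 2 :=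
    ((hw 0).mono one_le_two).congr fun δ _ => congrFun (newtonMoments_eq v δ) 0
  have h₁ : IsOrder 1 fun δ => (v δ 1 + 2 * v δ 2) / 2 :=
    IsOrder.of_pow_mul (m := 1) <| (hw 1).congr fun δ _ => by rw [newtonMoments_eq, pow_one]; rfl
  have h₂ : IsOrder 1 fun δ => v δ - v δ 2 • !₂[1, -2, 1] := by
    refine IsOrder.of_coord fun i => ?_
    match i with
    | 0 =>
      refine (h₀.sub (h₁.const_mul 2)).congr fun δ _ => ?_
      simp only [PiLp.sub_apply, PiLp.smul_apply, smul_eq_mul, cons_val]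
      ring
    | 1 =>
      refine (h₁.const_mul 2).congr fun δ _ => ?_
      simp only [PiLp.sub_apply, PiLp.smul_apply, smul_eq_mul, cons_val]
      ring
    | 2 =>
      refine (isBigO_zero _ _).congr_left fun δ => ?_
      simp only [PiLp.sub_apply, PiLp.smul_apply, smul_eq_mul, cons_val]
      ring
  simpa only [norm_one_neg_two_one, one_div] using
    hasLeadingTerm_of_norm_eq_one (by simp) h.norm_eq_one hv h₂

theorem moments_of_direction_one_neg_two_one (h : IsNewtonEigenpair M l v)
    (hM : ∀ i j, HasLeadingTerm 0 (N i j) fun δ => M δ i j) (hl : IsOrder 4 l)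
    (hc : (N 0 ⨯₃ N 1) 2 ≠ 0) (hv : HasLeadingTerm 0 ((1 / √6) • !₂[1, -2, 1]) v) (k : Fin 3) :
    HasLeadingTerm 2 ((N 0 ⨯₃ N 1) k / (4 * √6 * (N 0 ⨯₃ N 1) 2))
      fun δ => newtonMoments v δ k := by
  have hc' := hasLeadingTerm_cross hM
  have hw₂ : HasLeadingTerm 2 (1 / (4 * √6)) fun δ => newtonMoments v δ 2 := by
    refine (hasLeadingTerm_newtonMoments hv 2).congr (fun _ _ => rfl) ?_
    rw [newtonMoments_eq]
    simp only [PiLp.smul_apply, smul_eq_mul, cons_val]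
    ring
  have hcw := (h.isOrder_moments_sub_cross hM hl k).hasLeadingTerm_zero.add ((hc' k).mul hw₂)
  refine (HasLeadingTerm.of_mul (hc' 2) hc (hcw.congr (fun δ _ => ?_) rfl)).congr
    (fun _ _ => rfl) ?_
  · exact sub_add_cancel _ _
  · field_simp
    ring

theorem eigenvalue_of_direction_one_neg_two_one (h : IsNewtonEigenpair M l v)
    (hM : ∀ i j, HasLeadingTerm 0 (N i j) fun δ => M δ i j) (hl : IsOrder 4 l)
    (hc : (N 0 ⨯₃ N 1) 2 ≠ 0) (hv : HasLeadingTerm 0 ((1 / √6) • !₂[1, -2, 1]) v) :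
    HasLeadingTerm 4 (N.det / (96 * (N 0 ⨯₃ N 1) 2)) l := by
  have hMw := HasLeadingTerm.mulVec hM (h.moments_of_direction_one_neg_two_one hM hl hc hv) 2
  have hp : HasLeadingTerm 0 √6 fun δ => v δ 0 - 2 * v δ 1 + v δ 2 := by
    refine (((hv.coord 0).sub ((hv.coord 1).const_mul 2)).add (hv.coord 2)).congr
      (fun _ _ => rfl) ?_
    simp only [PiLp.smul_apply, smul_eq_mul, cons_val]
    field_simp
    norm_num
  refine (HasLeadingTerm.of_mul hp (by positivity) (((hasLeadingTerm_mul_pow (1 / 4) 2).mul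
    hMw).congr (fun δ hδ => ?_) rfl)).congr (fun _ _ => rfl) ?_
  · linear_combination 1 / 4 * h.row_two hδ
  · have hdet : N.det = N 2 ⬝ᵥ (N 0 ⨯₃ N 1) := by
      rw [det_fin_three, cross_apply, vec3_dotProduct]
      simp only [cons_val]
      ring
    have hN : (N *ᵥ fun k => (N 0 ⨯₃ N 1) k / (4 * √6 * (N 0 ⨯₃ N 1) 2)) 2 =
        N.det / (4 * √6 * (N 0 ⨯₃ N 1) 2) := by
      simp only [hdet, mulVec, dotProduct, mul_div_assoc', Finset.sum_div]
    rw [hN]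
    field_simp
    rw [Real.sq_sqrt (by norm_num)]
    ring

end Smallest

section Middle

theorem isOrder_moments_of_orthogonal (h : IsNewtonEigenpair M l v)
    {u : ℝ → EuclideanSpace ℝ (Fin 3)} (hu : HasLeadingTerm 0 ((1 / √3) • !₂[1, 1, 1]) u)
    (huv : ∀ δ, inner ℝ (u δ) (v δ) = 0) (k : Fin 3) :
    IsOrder 1 fun δ => newtonMoments v δ k := by
  match k with
  | 0 =>
    refine ((isOrder_inner_of_orthogonal hu h.norm_eq_one huv).const_mul √3).congr fun δ _ => ?_
    rw [newtonMoments_eq, real_inner_smul_left]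
    simp [PiLp.inner_apply, Fin.sum_univ_three]
  | 1 => exact h.isOrder_moments 1
  | 2 => exact (h.isOrder_moments 2).mono one_le_two

theorem isOrder_eigenvalue (h : IsNewtonEigenpair M l v)
    (hM : ∀ i j, HasLeadingTerm 0 (N i j) fun δ => M δ i j) {n : ℕ}
    (hw : ∀ k, IsOrder n fun δ => newtonMoments v δ k) : IsOrder (n + n) l :=
  (IsOrder.dotProduct hw (HasLeadingTerm.isOrder_mulVec hM hw)).congr fun _ hδ =>
    h.dotProduct_mulVec_moments hδ

theorem direction_of_orthogonal (h : IsNewtonEigenpair M l v)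
    {u : ℝ → EuclideanSpace ℝ (Fin 3)} (hu : HasLeadingTerm 0 ((1 / √6) • !₂[1, -2, 1]) u)
    (huv : ∀ δ, inner ℝ (u δ) (v δ) = 0) (hw : IsOrder 1 fun δ => newtonMoments v δ 0)
    (hv : ∀ δ, 0 ≤ v δ 0) : HasLeadingTerm 0 ((1 / √2) • !₂[1, 0, -1]) v := by
  have h₀ : IsOrder 1 fun δ => v δ 0 + v δ 1 + v δ 2 :=
    hw.congr fun δ _ => congrFun (newtonMoments_eq v δ) 0
  have h₁ : IsOrder 1 fun δ => v δ 0 - 2 * v δ 1 + v δ 2 := by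
    refine ((isOrder_inner_of_orthogonal hu h.norm_eq_one huv).const_mul √6).congr fun δ _ => ?_
    rw [real_inner_smul_left]
    rw [EuclideanSpace.inner_eq_star_dotProduct, star_trivial, vec3_dotProduct]
    simp only [cons_val]
    field_simp
    ring
  have h₂ : IsOrder 1 fun δ => v δ - v δ 0 • !₂[1, 0, -1] := by
    refine IsOrder.of_coord fun i => ?_
    match i with
    | 0 =>
      refine (isBigO_zero _ _).congr_left fun δ => ?_
      simp only [PiLp.sub_apply, PiLp.smul_apply, smul_eq_mul, cons_val]
      ring
    | 1 =>
      refine ((h₀.sub h₁).const_mul (1 / 3)).congr fun δ _ => ?_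
      simp only [PiLp.sub_apply, PiLp.smul_apply, smul_eq_mul, cons_val]
      ring
    | 2 =>
      refine (((h₀.const_mul 2).add h₁).const_mul (1 / 3)).congr fun δ _ => ?_
      simp only [PiLp.sub_apply, PiLp.smul_apply, smul_eq_mul, cons_val]
      ring
  simpa only [norm_one_zero_neg_one, one_div] using
    hasLeadingTerm_of_norm_eq_one (by simp) h.norm_eq_one hv h₂

theorem moments_of_direction_one_zero_neg_one (h : IsNewtonEigenpair M l v)
    (hM : ∀ i j, HasLeadingTerm 0 (N i j) fun δ => M δ i j) (hl : IsOrder 2 l)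
    (hN : N 0 0 ≠ 0) (hv : HasLeadingTerm 0 ((1 / √2) • !₂[1, 0, -1]) v) (k : Fin 3) :
    HasLeadingTerm 1 (![N 0 1 / (√2 * N 0 0), -(1 / √2), 0] k) fun δ => newtonMoments v δ k := by
  have hw₁ : HasLeadingTerm 1 (-(1 / √2)) fun δ => newtonMoments v δ 1 := by
    refine (hasLeadingTerm_newtonMoments hv 1).congr (fun _ _ => rfl) ?_
    rw [newtonMoments_eq]
    simp only [PiLp.smul_apply, smul_eq_mul, cons_val]
    ring
  match k with
  | 0 =>
    have hy : IsOrder 2 fun δ => l δ * v δ 0 - M δ 0 2 * newtonMoments v δ 2 :=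
      (hl.mul (h.isOrder_coord 0)).sub (by
        simpa only [zero_add] using! (hM 0 2).isOrder.mul (h.isOrder_moments 2))
    refine (HasLeadingTerm.of_mul (hM 0 0) hN
      ((hy.hasLeadingTerm_zero.sub ((hM 0 1).mul hw₁)).congr (fun δ hδ => ?_) rfl)).congr
      (fun _ _ => rfl) ?_
    · rw [← h.row_zero hδ, mulVec, vec3_dotProduct]
      ring
    · simp only [cons_val]
      field_simp
      ring
  | 1 => exact hw₁
  | 2 => exact (h.isOrder_moments 2).hasLeadingTerm_zero

theorem eigenvalue_of_direction_one_zero_neg_one (h : IsNewtonEigenpair M l v)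
    (hM : ∀ i j, HasLeadingTerm 0 (N i j) fun δ => M δ i j) (hl : IsOrder 2 l)
    (hN : N 0 0 ≠ 0) (hv : HasLeadingTerm 0 ((1 / √2) • !₂[1, 0, -1]) v) :
    HasLeadingTerm 2 ((N 0 ⨯₃ N 1) 2 / (2 * N 0 0)) l := by
  have hMw := HasLeadingTerm.mulVec hM (h.moments_of_direction_one_zero_neg_one hM hl hN hv) 1
  have hp : HasLeadingTerm 0 (-(1 / √2)) fun δ => v δ 1 - v δ 0 := by
    refine ((hv.coord 1).sub (hv.coord 0)).congr (fun _ _ => rfl) ?_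
    simp
  have hMw' : HasLeadingTerm 2 _ fun δ => (v δ 1 - v δ 0) * l δ :=
    ((hasLeadingTerm_mul_pow (1 / 2) 1).mul hMw).congr
      (fun δ hδ => by linear_combination 1 / 2 * h.row_one hδ) rfl
  refine (HasLeadingTerm.of_mul hp (neg_ne_zero.2 (by positivity)) hMw').congr (fun _ _ => rfl) ?_
  rw [mulVec, vec3_dotProduct, cross_apply]
  simp only [cons_val]
  field_simp
  ring

end Middle

end IsNewtonEigenpair

end Eigenpair

section Spectrum

open Matrix

variable {n : Type*} [Fintype n] [DecidableEq n] {A : Matrix n n ℝ} {c : ℝ}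

theorem dotProduct_mulVec_eq_sum_eigenvalues (hA : A.IsHermitian) (y : EuclideanSpace ℝ n) :
    y.ofLp ⬝ᵥ A *ᵥ y = ∑ i, hA.eigenvalues i * inner ℝ (hA.eigenvectorBasis i) y ^ 2 := by
  have hself : (toEuclideanLin A).IsSymmetric := isSymmetric_toEuclideanLin_iff.2 hA
  have heig (i : n) : toEuclideanLin A (hA.eigenvectorBasis i) =
      hA.eigenvalues i • hA.eigenvectorBasis i := by
    ext j
    exact congrFun (hA.mulVec_eigenvectorBasis i) j
  calc y.ofLp ⬝ᵥ A *ᵥ y = inner ℝ y (toEuclideanLin A y) := by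
        rw [dotProduct_comm, EuclideanSpace.inner_eq_star_dotProduct, star_trivial]
        rfl
    _ = ∑ i, inner ℝ y (hA.eigenvectorBasis i) *
          inner ℝ (hA.eigenvectorBasis i) (toEuclideanLin A y) :=
        (hA.eigenvectorBasis.sum_inner_mul_inner _ _).symm
    _ = ∑ i, hA.eigenvalues i * inner ℝ (hA.eigenvectorBasis i) y ^ 2 := by
        refine Finset.sum_congr rfl fun i _ => ?_
        rw [← hself, heig, real_inner_smul_left, real_inner_comm]
        ring

theorem dotProduct_mulVec_le_of_eigenvalues_le (hA : A.IsHermitian)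
    (hc : ∀ i, hA.eigenvalues i ≤ c) (y : EuclideanSpace ℝ n) :
    y.ofLp ⬝ᵥ A *ᵥ y ≤ c * ‖y‖ ^ 2 := by
  rw [dotProduct_mulVec_eq_sum_eigenvalues hA, ← hA.eigenvectorBasis.sum_sq_inner_right y,
    Finset.mul_sum]
  gcongr with i
  exact hc i

theorem le_dotProduct_mulVec_of_le_eigenvalues (hA : A.IsHermitian)
    (hc : ∀ i, c ≤ hA.eigenvalues i) (y : EuclideanSpace ℝ n) :
    c * ‖y‖ ^ 2 ≤ y.ofLp ⬝ᵥ A *ᵥ y := by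
  rw [dotProduct_mulVec_eq_sum_eigenvalues hA, ← hA.eigenvectorBasis.sum_sq_inner_right y,
    Finset.mul_sum]
  gcongr with i
  exact hc i

end Spectrum

section CovarianceSpectrum

open Matrix

variable {Ω : Type*} [MeasurableSpace Ω] {P : Measure Ω} {X : Ω → EuclideanSpace ℝ (Fin 3)}

theorem posSemidef_covMatrix [IsFiniteMeasure P]
    (hX : ∀ i, MemLp (fun ω => X ω i) 2 P) : (covMatrix P X).PosSemidef := by
  refine PosSemidef.of_dotProduct_mulVec_nonneg (covMatrix_isHermitian P X) fun c => ?_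
  have hvar : star c ⬝ᵥ covMatrix P X *ᵥ c = Var[fun ω => ∑ i, c i * X ω i; P] := by
    rw [variance_fun_sum fun i => (hX i).const_mul (c i)]
    simp only [dotProduct, mulVec, covMatrix, of_apply, star_trivial, Finset.mul_sum,
      covariance_const_mul_left, covariance_const_mul_right]
    exact Finset.sum_congr rfl fun i _ => Finset.sum_congr rfl fun j _ => by ring
  exact hvar ▸ variance_nonneg _ _

variable (P X)

theorem monotone_covEigenvalue : Monotone (covEigenvalue P X) := fun _ _ h =>
  (covMatrix_isHermitian P X).eigenvalues₀_antitone (Fin.rev_le_rev.2 h)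

theorem exists_equiv_covEigenvalue : ∃ σ : Fin 3 ≃ Fin 3,
    ∀ k, (covMatrix_isHermitian P X).eigenvalues (σ k) = covEigenvalue P X k :=
  ⟨(Fin.revPerm.trans (finCongr (Fintype.card_fin 3).symm)).trans
    (Fintype.equivOfCardEq (Fintype.card_fin _)), fun k => by
      rw [IsHermitian.eigenvalues, Equiv.trans_apply, Equiv.symm_apply_apply]
      rfl⟩

theorem covEigenvalue_pos {P : Measure Ω} {X : Ω → EuclideanSpace ℝ (Fin 3)}
    (hC : (covMatrix P X).PosDef) (k : Fin 3) :
    0 < covEigenvalue P X k := by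
  obtain ⟨σ, hσ⟩ := exists_equiv_covEigenvalue P X
  rw [← hσ]
  exact hC.eigenvalues_pos _

theorem covEigenvalue_zero_mul_le (y : EuclideanSpace ℝ (Fin 3)) :
    covEigenvalue P X 0 * ‖y‖ ^ 2 ≤ y.ofLp ⬝ᵥ covMatrix P X *ᵥ y := by
  obtain ⟨σ, hσ⟩ := exists_equiv_covEigenvalue P X
  refine le_dotProduct_mulVec_of_le_eigenvalues (covMatrix_isHermitian P X)
    (σ.forall_congr_right.1 fun k => ?_) y
  exact hσ k ▸ monotone_covEigenvalue P X (Fin.zero_le k)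

theorem le_covEigenvalue_two_mul (y : EuclideanSpace ℝ (Fin 3)) :
    y.ofLp ⬝ᵥ covMatrix P X *ᵥ y ≤ covEigenvalue P X 2 * ‖y‖ ^ 2 := by
  obtain ⟨σ, hσ⟩ := exists_equiv_covEigenvalue P X
  refine dotProduct_mulVec_le_of_eigenvalues_le (covMatrix_isHermitian P X)
    (σ.forall_congr_right.1 fun k => ?_) y
  exact hσ k ▸ monotone_covEigenvalue P X (Fin.le_last k)

theorem exists_orthonormal_eigenvectors (c : Fin 3 → Fin 3) :
    ∃ v : Fin 3 → EuclideanSpace ℝ (Fin 3), Orthonormal ℝ v ∧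
      (∀ k, toEuclideanLin (covMatrix P X) (v k) = covEigenvalue P X k • v k) ∧
      ∀ k, 0 ≤ v k (c k) := by
  obtain ⟨σ, hσ⟩ := exists_equiv_covEigenvalue P X
  set e : Fin 3 → EuclideanSpace ℝ (Fin 3) :=
    fun k => (covMatrix_isHermitian P X).eigenvectorBasis (σ k)
  have he : Orthonormal ℝ e := (OrthonormalBasis.orthonormal _).comp σ σ.injective
  have heig (k : Fin 3) : toEuclideanLin (covMatrix P X) (e k) = covEigenvalue P X k • e k := by
    ext i
    rw [← hσ]
    exact congrFun ((covMatrix_isHermitian P X).mulVec_eigenvectorBasis (σ k)) i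
  have hsign (k : Fin 3) : ∃ s : ℝ, |s| = 1 ∧ 0 ≤ s * e k (c k) :=
    (le_total 0 (e k (c k))).elim (fun h => ⟨1, abs_one, by rwa [one_mul]⟩)
      fun h => ⟨-1, by rw [abs_neg, abs_one], by linarith⟩
  choose s hs hs' using hsign
  refine ⟨fun k => s k • e k, ⟨fun k => ?_, fun i j hij => ?_⟩, fun k => ?_, hs'⟩
  · rw [norm_smul, Real.norm_eq_abs, hs, he.1, one_mul]
  · dsimp only
    rw [real_inner_smul_left, real_inner_smul_right, he.2 hij, mul_zero, mul_zero]
  · rw [map_smul, heig, smul_comm]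

end CovarianceSpectrum

section Covariance

open Matrix

variable {Ω : Type*} [MeasurableSpace Ω]

/-- The matrix of mixed divided differences of the spatial correlation function at `(x, x)`, with
step `δ/2`. -/
def corrDivDiff (P : Measure Ω) (u : ℝ → Ω → ℝ) (x δ : ℝ) : Matrix (Fin 3) (Fin 3) ℝ :=
  Matrix.of fun k l : Fin 3 => divDiff₂ k l (corr P u) x (δ / 2)

variable {P : Measure Ω} {a b x δ : ℝ} {u : ℝ → Ω → ℝ}

theorem sample_apply (f : ℝ → ℝ) (x δ : ℝ) (i : Fin 3) :
    sample f x δ i = f (x + i * (δ / 2)) := by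
  fin_cases i <;> simp [sample, mul_div_cancel₀]

theorem covMatrix_T_eq (hδ : 0 < δ) : covMatrix P (T u x δ) =
    newtonMatrix 3 (δ / 2) * corrDivDiff P u x δ * (newtonMatrix 3 (δ / 2))ᵀ := by
  rw [corrDivDiff, newtonMatrix_mul_divDiff₂_mul_transpose 3 _ x (half_pos hδ).ne']
  simp only [covMatrix, T, sample_apply]
  rfl

theorem dotProduct_covMatrix_T_mulVec (hδ : 0 < δ) (y : EuclideanSpace ℝ (Fin 3)) :
    y.ofLp ⬝ᵥ covMatrix P (T u x δ) *ᵥ y =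
      newtonMoments (fun _ => y) δ ⬝ᵥ corrDivDiff P u x δ *ᵥ newtonMoments (fun _ => y) δ := by
  rw [covMatrix_T_eq hδ, newtonMoments, ← mulVec_mulVec, ← mulVec_mulVec, dotProduct_mulVec,
    ← mulVec_transpose]

theorem hasLeadingTerm_corrDivDiff (hx : x ∈ Ico a b) (hR : IsSmoothNearDiag 3 a b (corr P u))
    (i j : Fin 3) :
    HasLeadingTerm 0 (corrMatrix a b (corr P u) x i j) fun δ => corrDivDiff P u x δ i j := by
  have hsymm (s t : ℝ) : corr P u s t = corr P u t s := covariance_comm _ _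
  have hcomm (k l : Fin 3) : diagDeriv a b (corr P u) k l x = diagDeriv a b (corr P u) l k x :=
    diagDeriv_comm hx hR hsymm k.isLt l.isLt
  have hij : corrMatrix a b (corr P u) x i j = diagDeriv a b (corr P u) i j x := by
    match i, j with
    | 0, 0 | 1, 0 | 1, 1 | 2, 0 | 2, 1 | 2, 2 => rfl
    | 0, 1 => exact hcomm 1 0
    | 0, 2 => exact hcomm 2 0
    | 1, 2 => exact hcomm 2 1
  rw [hij]
  exact (hasLeadingTerm_divDiff₂ hx hR i.isLt j.isLt).comp_half

theorem cross_corrMatrix (a b : ℝ) (R : ℝ → ℝ → ℝ) (x : ℝ) :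
    corrMatrix a b R x 0 ⨯₃ corrMatrix a b R x 1 =
      ![minor31 a b R x, -minor32 a b R x, minor33 a b R x] := by
  rw [cross_apply]
  ext k
  match k with
  | 0 | 1 | 2 =>
    simp only [corrMatrix, minor31, minor32, minor33, of_apply, cons_val]
    ring

theorem diagDeriv_zero_pos {R : ℝ → ℝ → ℝ} (hN : (corrMatrix a b R x).PosDef) :
    0 < diagDeriv a b R 0 0 x := hN.diag_pos (i := 0)

theorem minor33_pos {R : ℝ → ℝ → ℝ} (hN : (corrMatrix a b R x).PosDef) : 0 < minor33 a b R x := by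
  have h₀ := diagDeriv_zero_pos hN
  have h := hN.dotProduct_mulVec_pos (x := ![-diagDeriv a b R 1 0 x, diagDeriv a b R 0 0 x, 0])
    fun h => h₀.ne' (congrFun h 1)
  refine pos_of_mul_pos_right (h.trans_eq ?_) h₀.le
  simp only [corrMatrix, minor33, vec3_dotProduct, mulVec, of_apply, cons_val, star_trivial]
  ring

theorem cross_corrMatrix_two_ne_zero {R : ℝ → ℝ → ℝ} (hN : (corrMatrix a b R x).PosDef) :
    (corrMatrix a b R x 0 ⨯₃ corrMatrix a b R x 1) 2 ≠ 0 := by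
  rw [cross_corrMatrix]
  exact (minor33_pos hN).ne'

theorem eventually_nodes_mem_Icc (hx : x ∈ Ico a b) :
    ∀ᶠ δ in 𝓝[>] 0, ∀ i : Fin 3, x + i * (δ / 2) ∈ Icc a b := by
  filter_upwards [self_mem_nhdsWithin, eventually_add_mul_le hx.2 1] with δ (hδ : 0 < δ) hb i
  refine Icc_subset_Icc hx.1 ?_ (nodes_mem_Icc (half_pos hδ).le (Nat.le_of_lt_succ i.isLt))
  linarith

theorem posSemidef_covMatrix_T [IsFiniteMeasure P] (hu : ∀ t ∈ Icc a b, MemLp (u t) 2 P)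
    (hT : ∀ i : Fin 3, x + i * (δ / 2) ∈ Icc a b) : (covMatrix P (T u x δ)).PosSemidef :=
  posSemidef_covMatrix fun i => by simpa only [T, sample_apply] using! hu _ (hT i)

theorem eventually_posDef_covMatrix_T [IsFiniteMeasure P] (hu : ∀ t ∈ Icc a b, MemLp (u t) 2 P)
    (hx : x ∈ Ico a b) (hR : IsSmoothNearDiag 3 a b (corr P u))
    (hN : (corrMatrix a b (corr P u) x).PosDef) :
    ∀ᶠ δ in 𝓝[>] 0, (covMatrix P (T u x δ)).PosDef := by
  have hdet : Tendsto (fun δ => (corrDivDiff P u x δ).det) (𝓝[>] 0)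
      (𝓝 (corrMatrix a b (corr P u) x).det) :=
    (continuous_id.matrix_det.tendsto _).comp <| tendsto_pi_nhds.2 fun i =>
      tendsto_pi_nhds.2 fun j => (hasLeadingTerm_corrDivDiff hx hR i j).tendsto
  filter_upwards [hdet.eventually_ne hN.det_pos.ne', self_mem_nhdsWithin,
    eventually_nodes_mem_Icc hx] with δ hM (hδ : 0 < δ) hT
  have hA := det_newtonMatrix_ne_zero 3 (half_pos hδ).ne'
  refine (posSemidef_covMatrix_T hu hT).posDef_iff_det_ne_zero.2 ?_
  rw [covMatrix_T_eq hδ, det_mul, det_mul, det_transpose]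
  exact mul_ne_zero (mul_ne_zero hA hM) hA

theorem diagDeriv_zero_le_covEigenvalue_two (P : Measure Ω) (u : ℝ → Ω → ℝ) (x δ : ℝ) :
    diagDeriv a b (corr P u) 0 0 x ≤ covEigenvalue P (T u x δ) 2 := by
  have h := le_covEigenvalue_two_mul P (T u x δ) (EuclideanSpace.single 0 1)
  simpa [covMatrix, T, sample, corr, diagDeriv] using h

theorem isOrder_covEigenvalue_zero [IsFiniteMeasure P] (hu : ∀ t ∈ Icc a b, MemLp (u t) 2 P)
    (hx : x ∈ Ico a b) (hR : IsSmoothNearDiag 3 a b (corr P u))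
    (hN : (corrMatrix a b (corr P u) x).PosDef) :
    IsOrder 4 fun δ => covEigenvalue P (T u x δ) 0 := by
  set e : EuclideanSpace ℝ (Fin 3) := !₂[1, -2, 1] with he
  have hw (δ : ℝ) : newtonMoments (fun _ => e) δ = ![0, 0, δ ^ 2 / 4] := by
    rw [newtonMoments_eq]
    ext k
    match k with
    | 0 | 1 | 2 => simp only [he, cons_val]; ring
  have hC : IsOrder 4 fun δ => δ ^ 4 * corrDivDiff P u x δ 2 2 :=
    (isOrder_pow 4).mul (hasLeadingTerm_corrDivDiff hx hR 2 2).isOrder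
  refine IsBigO.trans (IsBigO.of_bound 1 ?_) hC
  filter_upwards [eventually_posDef_covMatrix_T hu hx hR hN, self_mem_nhdsWithin]
    with δ hpos (hδ : 0 < δ)
  have hl := covEigenvalue_pos hpos 0
  have h := covEigenvalue_zero_mul_le P (T u x δ) e
  rw [dotProduct_covMatrix_T_mulVec hδ, hw, norm_one_neg_two_one, Real.sq_sqrt (by norm_num)] at h
  simp only [vec3_dotProduct, mulVec, cons_val] at h
  rw [one_mul, Real.norm_of_nonneg hl.le]
  refine le_trans ?_ (le_abs_self _)
  linarith

end Covariance

section Eigenframe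

open Matrix

variable {Ω : Type*} [MeasurableSpace Ω] {P : Measure Ω} {a b x : ℝ} {u : ℝ → Ω → ℝ}

/-- An orthonormal eigenbasis `v₁(δ), v₂(δ), v₃(δ)` of the covariance matrix of `T(δ)`, ordered by
increasing eigenvalue. The signs are those of the last, first and last entries of the limits
`(1, -2, 1)`, `(1, 0, -1)` and `(1, 1, 1)`. -/
structure IsEigenframe (P : Measure Ω) (u : ℝ → Ω → ℝ) (x : ℝ)
    (v : Fin 3 → ℝ → EuclideanSpace ℝ (Fin 3)) : Prop where
  orthonormal : ∀ δ, Orthonormal ℝ fun k => v k δ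
  eigen : ∀ δ k, toEuclideanLin (covMatrix P (T u x δ)) (v k δ) =
    covEigenvalue P (T u x δ) k • v k δ
  nonneg : ∀ δ k, 0 ≤ v k δ (![2, 0, 2] k)

theorem exists_isEigenframe (P : Measure Ω) (u : ℝ → Ω → ℝ) (x : ℝ) :
    ∃ v, IsEigenframe P u x v := by
  choose w h₁ h₂ h₃ using fun δ => exists_orthonormal_eigenvectors P (T u x δ) ![2, 0, 2]
  exact ⟨fun k δ => w δ k, h₁, h₂, h₃⟩

theorem hasLeadingTerm_inner_sample {n : ℕ} {μ : ℝ → ℝ} {v : ℝ → EuclideanSpace ℝ (Fin 3)}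
    {ω : Fin 3 → ℝ} (hx : x ∈ Ico a b) (hμ : ContDiffOn ℝ 3 μ (Icc a b))
    (hv : ∀ k, HasLeadingTerm n (ω k) fun δ => newtonMoments v δ k) :
    HasLeadingTerm n
      (μ x * ω 0 + derivWithin μ (Icc a b) x * ω 1 + iteratedDerivWithin 2 μ (Icc a b) x * ω 2)
      fun δ => inner ℝ (sample μ x δ) (v δ) := by
  have hD (k : Fin 3) : HasLeadingTerm 0 (iteratedDerivWithin k μ (Icc a b) x)
      fun δ => divDiff k μ x (δ / 2) :=
    (hasLeadingTerm_divDiff hx (hμ.of_le (by exact_mod_cast k.isLt))).comp_half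
  have hsample {δ : ℝ} (hδ : 0 < δ) : (sample μ x δ).ofLp =
      newtonMatrix 3 (δ / 2) *ᵥ fun k : Fin 3 => divDiff k μ x (δ / 2) := by
    ext i
    rw [sample_apply, ← sum_newtonMatrix_mul_divDiff 3 μ x (half_pos hδ).ne' i]
    rfl
  have h := HasLeadingTerm.dotProduct hD hv
  rw [zero_add] at h
  refine h.congr (fun δ hδ => ?_) ?_
  · rw [EuclideanSpace.inner_eq_star_dotProduct, star_trivial, hsample hδ, dotProduct_mulVec,
      ← mulVec_transpose, dotProduct_comm, newtonMoments]
  · rw [dotProduct, Fin.sum_univ_three]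
    simp only [Fin.val_zero, Fin.val_one, Fin.val_two, iteratedDerivWithin_zero,
      iteratedDerivWithin_one]

namespace IsEigenframe

variable {v : Fin 3 → ℝ → EuclideanSpace ℝ (Fin 3)}

theorem inner_eq_zero (h : IsEigenframe P u x v) {j k : Fin 3} (hjk : j ≠ k) (δ : ℝ) :
    inner ℝ (v j δ) (v k δ) = 0 :=
  (h.orthonormal δ).inner_eq_zero hjk

theorem isNewtonEigenpair (h : IsEigenframe P u x v) (k : Fin 3) :
    IsNewtonEigenpair (corrDivDiff P u x) (fun δ => covEigenvalue P (T u x δ) k) (v k) where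
  norm_eq_one δ := (h.orthonormal δ).norm_eq_one k
  eigen δ hδ := by rw [← covMatrix_T_eq hδ]; exact congrArg WithLp.ofLp (h.eigen δ k)

variable (h : IsEigenframe P u x v) (hx : x ∈ Ico a b) (hR : IsSmoothNearDiag 3 a b (corr P u))
  (hN : (corrMatrix a b (corr P u) x).PosDef)

include h hx hR hN

theorem direction_two : HasLeadingTerm 0 ((1 / √3) • !₂[1, 1, 1]) (v 2) :=
  (h.isNewtonEigenpair 2).direction_of_eigenvalue_ge (hasLeadingTerm_corrDivDiff hx hR)
    (diagDeriv_zero_pos hN)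
    (Eventually.of_forall fun δ => diagDeriv_zero_le_covEigenvalue_two P u x δ)
    fun δ => h.nonneg δ 2

theorem direction_zero [IsFiniteMeasure P] (hu : ∀ t ∈ Icc a b, MemLp (u t) 2 P) :
    HasLeadingTerm 0 ((1 / √6) • !₂[1, -2, 1]) (v 0) :=
  (h.isNewtonEigenpair 0).direction_of_isOrder_four (hasLeadingTerm_corrDivDiff hx hR)
    (isOrder_covEigenvalue_zero hu hx hR hN) (cross_corrMatrix_two_ne_zero hN)
    fun δ => h.nonneg δ 0

theorem isOrder_moments_one (k : Fin 3) : IsOrder 1 fun δ => newtonMoments (v 1) δ k :=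
  (h.isNewtonEigenpair 1).isOrder_moments_of_orthogonal (h.direction_two hx hR hN)
    (h.inner_eq_zero (by decide)) k

theorem isOrder_eigenvalue_one : IsOrder 2 fun δ => covEigenvalue P (T u x δ) 1 :=
  (h.isNewtonEigenpair 1).isOrder_eigenvalue (hasLeadingTerm_corrDivDiff hx hR)
    (h.isOrder_moments_one hx hR hN)

theorem direction_one [IsFiniteMeasure P] (hu : ∀ t ∈ Icc a b, MemLp (u t) 2 P) :
    HasLeadingTerm 0 ((1 / √2) • !₂[1, 0, -1]) (v 1) :=
  (h.isNewtonEigenpair 1).direction_of_orthogonal (h.direction_zero hx hR hN hu)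
    (h.inner_eq_zero (by decide)) (h.isOrder_moments_one hx hR hN 0) fun δ => h.nonneg δ 1

theorem eigenvalue_two : HasLeadingTerm 0 (3 * diagDeriv a b (corr P u) 0 0 x)
    fun δ => covEigenvalue P (T u x δ) 2 :=
  (h.isNewtonEigenpair 2).eigenvalue_of_direction_one_one_one (hasLeadingTerm_corrDivDiff hx hR)
    (h.direction_two hx hR hN)

theorem eigenvalue_one [IsFiniteMeasure P] (hu : ∀ t ∈ Icc a b, MemLp (u t) 2 P) :
    HasLeadingTerm 2 (minor33 a b (corr P u) x / (2 * diagDeriv a b (corr P u) 0 0 x))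
      fun δ => covEigenvalue P (T u x δ) 1 := by
  have hl := (h.isNewtonEigenpair 1).eigenvalue_of_direction_one_zero_neg_one
    (hasLeadingTerm_corrDivDiff hx hR) (h.isOrder_eigenvalue_one hx hR hN)
    (diagDeriv_zero_pos hN).ne' (h.direction_one hx hR hN hu)
  rwa [cross_corrMatrix] at hl

theorem eigenvalue_zero [IsFiniteMeasure P] (hu : ∀ t ∈ Icc a b, MemLp (u t) 2 P) :
    HasLeadingTerm 4
      ((corrMatrix a b (corr P u) x).det / (96 * minor33 a b (corr P u) x))
      fun δ => covEigenvalue P (T u x δ) 0 := by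
  have hl := (h.isNewtonEigenpair 0).eigenvalue_of_direction_one_neg_two_one
    (hasLeadingTerm_corrDivDiff hx hR) (isOrder_covEigenvalue_zero hu hx hR hN)
    (cross_corrMatrix_two_ne_zero hN) (h.direction_zero hx hR hN hu)
  rwa [cross_corrMatrix] at hl

variable {μ : ℝ → ℝ} (hμ : ContDiffOn ℝ 3 μ (Icc a b))

include hμ

theorem inner_sample_two :
    HasLeadingTerm 0 (√3 * μ x) fun δ => inner ℝ (sample μ x δ) (v 2 δ) := by
  have hω := IsNewtonEigenpair.moments_of_direction_one_one_one (h.direction_two hx hR hN)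
  refine (hasLeadingTerm_inner_sample hx hμ hω).congr (fun _ _ => rfl) ?_
  simp only [cons_val]
  ring

theorem inner_sample_one [IsFiniteMeasure P] (hu : ∀ t ∈ Icc a b, MemLp (u t) 2 P) :
    HasLeadingTerm 1
      ((diagDeriv a b (corr P u) 1 0 x * μ x -
        diagDeriv a b (corr P u) 0 0 x * derivWithin μ (Icc a b) x) /
        (√2 * diagDeriv a b (corr P u) 0 0 x))
      fun δ => inner ℝ (sample μ x δ) (v 1 δ) := by
  have h₀ := (diagDeriv_zero_pos hN).ne'
  have hω := (h.isNewtonEigenpair 1).moments_of_direction_one_zero_neg_one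
    (hasLeadingTerm_corrDivDiff hx hR) (h.isOrder_eigenvalue_one hx hR hN) h₀
    (h.direction_one hx hR hN hu)
  refine (hasLeadingTerm_inner_sample hx hμ hω).congr (fun _ _ => rfl) ?_
  simp only [corrMatrix, of_apply, cons_val]
  field_simp
  ring

theorem inner_sample_zero [IsFiniteMeasure P] (hu : ∀ t ∈ Icc a b, MemLp (u t) 2 P) :
    HasLeadingTerm 2
      ((minor31 a b (corr P u) x * μ x - minor32 a b (corr P u) x * derivWithin μ (Icc a b) x +
        minor33 a b (corr P u) x * iteratedDerivWithin 2 μ (Icc a b) x) /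
        (4 * √6 * minor33 a b (corr P u) x))
      fun δ => inner ℝ (sample μ x δ) (v 0 δ) := by
  have hω := (h.isNewtonEigenpair 0).moments_of_direction_one_neg_two_one
    (hasLeadingTerm_corrDivDiff hx hR) (isOrder_covEigenvalue_zero hu hx hR hN)
    (cross_corrMatrix_two_ne_zero hN) (h.direction_zero hx hR hN hu)
  refine (hasLeadingTerm_inner_sample hx hμ hω).congr (fun _ _ => rfl) ?_
  simp only [cross_corrMatrix, cons_val]
  ring

end IsEigenframe

end Eigenframe

section Gaussian

variable {Ω : Type*} [MeasurableSpace Ω] {P : Measure Ω} {a b x δ : ℝ} {u : ℝ → Ω → ℝ}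

theorem memLp_of_gaussian (hu : IsGaussianProcess (fun t : Icc a b => u t) P) :
    ∀ t ∈ Icc a b, MemLp (u t) 2 P := fun t ht =>
  (hu.hasGaussianLaw_eval ⟨t, ht⟩).memLp_two

theorem hasGaussianLaw_T (hu : IsGaussianProcess (fun t : Icc a b => u t) P)
    (hT : ∀ i : Fin 3, x + i * (δ / 2) ∈ Icc a b) : HasGaussianLaw (T u x δ) P := by
  classical
  let y (i : Fin 3) : Icc a b := ⟨x + i * (δ / 2), hT i⟩
  let L : (Finset.univ.image y → ℝ) →L[ℝ] EuclideanSpace ℝ (Fin 3) :=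
    (EuclideanSpace.equiv (Fin 3) ℝ).symm.toContinuousLinearMap.comp <| .pi fun i =>
      .proj ⟨y i, Finset.mem_image_of_mem y (Finset.mem_univ i)⟩
  have hL : T u x δ = fun ω => L ((Finset.univ.image y).restrict fun t => u t ω) := by
    ext ω i
    exact sample_apply _ x δ i
  exact hL ▸ (hu.hasGaussianLaw (Finset.univ.image y)).map_fun L

theorem eventually_hasGaussianLaw_T_and_centered (hu : G1 P a b u) (hx : x ∈ Ico a b) :
    ∀ᶠ δ in 𝓝[>] 0, HasGaussianLaw (T u x δ) P ∧ ∀ i, ∫ ω, T u x δ ω i ∂P = 0 := by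
  filter_upwards [eventually_nodes_mem_Icc hx] with δ hT
  refine ⟨hasGaussianLaw_T hu.gaussian hT, fun i => ?_⟩
  simpa only [T, sample_apply] using hu.centered _ (hT i)

end Gaussian

end CorrSamp

end

theorem lemma5p1_general {Ω : Type*} [MeasurableSpace Ω] (P : Measure Ω) [IsFiniteMeasure P]
    (a b : ℝ) (u : ℝ → Ω → ℝ) (hu : ∀ t ∈ Icc a b, MemLp (u t) 2 P)
    (hR : CorrSamp.IsSmoothNearDiag 3 a b (CorrSamp.corr P u)) (x : ℝ) (hx : x ∈ Ico a b)
    (hN : (CorrSamp.corrMatrix a b (CorrSamp.corr P u) x).PosDef) :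
    let R : ℕ → ℕ → ℝ := fun k l => CorrSamp.diagDeriv a b (CorrSamp.corr P u) k l x
    let detR : ℝ := (CorrSamp.corrMatrix a b (CorrSamp.corr P u) x).det
    let m33 : ℝ := CorrSamp.minor33 a b (CorrSamp.corr P u) x
    let m32 : ℝ := CorrSamp.minor32 a b (CorrSamp.corr P u) x
    let m31 : ℝ := CorrSamp.minor31 a b (CorrSamp.corr P u) x
    let C : ℝ → Matrix (Fin 3) (Fin 3) ℝ := fun δ => CorrSamp.covMatrix P (CorrSamp.T u x δ)
    let lam : Fin 3 → ℝ → ℝ := fun k δ => CorrSamp.covEigenvalue P (CorrSamp.T u x δ) k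
    (∀ᶠ δ in 𝓝[>] (0 : ℝ), (C δ).PosDef) ∧
    (∀ᶠ δ in 𝓝[>] (0 : ℝ), 0 < lam 0 δ ∧ lam 0 δ ≤ lam 1 δ ∧ lam 1 δ ≤ lam 2 δ) ∧
    ((fun δ => lam 0 δ - detR / (96 * m33) * δ ^ 4) =O[𝓝[>] 0] fun δ => δ ^ 5) ∧
    ((fun δ => lam 1 δ - m33 / (2 * R 0 0) * δ ^ 2) =O[𝓝[>] 0] fun δ => δ ^ 3) ∧
    ((fun δ => lam 2 δ - 3 * R 0 0) =O[𝓝[>] 0] fun δ => δ) ∧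
    ∃ v : Fin 3 → ℝ → EuclideanSpace ℝ (Fin 3),
      (∀ᶠ δ in 𝓝[>] (0 : ℝ), Orthonormal ℝ (fun k => v k δ) ∧
        ∀ k, Matrix.toEuclideanLin (C δ) (v k δ) = lam k δ • v k δ) ∧
      Tendsto (v 0) (𝓝[>] 0) (𝓝 ((1 / √6) • !₂[1, -2, 1])) ∧
      Tendsto (v 1) (𝓝[>] 0) (𝓝 ((1 / √2) • !₂[1, 0, -1])) ∧
      Tendsto (v 2) (𝓝[>] 0) (𝓝 ((1 / √3) • !₂[1, 1, 1])) ∧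
      ∀ μ : ℝ → ℝ, ContDiffOn ℝ 3 μ (Icc a b) →
        let μ' : ℝ := derivWithin μ (Icc a b) x
        let μ'' : ℝ := iteratedDerivWithin 2 μ (Icc a b) x
        let τ : ℝ → EuclideanSpace ℝ (Fin 3) := fun δ => CorrSamp.sample μ x δ
        ((fun δ => inner ℝ (τ δ) (v 0 δ) -
            (m31 * μ x - m32 * μ' + m33 * μ'') / (4 * √6 * m33) * δ ^ 2)
          =O[𝓝[>] 0] fun δ => δ ^ 3) ∧
        ((fun δ => inner ℝ (τ δ) (v 1 δ) - (R 1 0 * μ x - R 0 0 * μ') / (√2 * R 0 0) * δ)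
          =O[𝓝[>] 0] fun δ => δ ^ 2) ∧
        ((fun δ => inner ℝ (τ δ) (v 2 δ) - √3 * μ x) =O[𝓝[>] 0] fun δ => δ) := by
  intro R detR m33 m32 m31 C lam
  have hpos := CorrSamp.eventually_posDef_covMatrix_T hu hx hR hN
  obtain ⟨v, hv⟩ := CorrSamp.exists_isEigenframe P u x
  refine ⟨hpos, hpos.mono fun δ hC => ⟨CorrSamp.covEigenvalue_pos hC 0, ?_, ?_⟩,
    (hv.eigenvalue_zero hx hR hN hu).isBigO, (hv.eigenvalue_one hx hR hN hu).isBigO, ?_, v,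
    Eventually.of_forall fun δ => ⟨hv.orthonormal δ, hv.eigen δ⟩,
    (hv.direction_zero hx hR hN hu).tendsto, (hv.direction_one hx hR hN hu).tendsto,
    (hv.direction_two hx hR hN).tendsto,
    fun μ hμ => ⟨(hv.inner_sample_zero hx hR hN hμ hu).isBigO, ?_, ?_⟩⟩
  · exact CorrSamp.monotone_covEigenvalue P _ (Fin.zero_le 1)
  · exact CorrSamp.monotone_covEigenvalue P _ (Fin.le_last 1)
  · simpa only [pow_zero, mul_one, zero_add, pow_one] using (hv.eigenvalue_two hx hR hN).isBigO
  · simpa only [pow_one] using (hv.inner_sample_one hx hR hN hμ hu).isBigO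
  · simpa only [pow_zero, mul_one, zero_add, pow_one] using
      (hv.inner_sample_two hx hR hN hμ).isBigO

theorem lemma5p1 {Ω : Type*} [MeasurableSpace Ω] (P : Measure Ω) [IsProbabilityMeasure P]
    (a b : ℝ) (u : ℝ → Ω → ℝ) (h1 : CorrSamp.G1 P a b u) (h2 : CorrSamp.G2 P a b u)
    (x : ℝ) (hx : x ∈ Ico a b) :
    let R : ℕ → ℕ → ℝ := fun k l => CorrSamp.diagDeriv a b (CorrSamp.corr P u) k l x
    let detR : ℝ := (CorrSamp.corrMatrix a b (CorrSamp.corr P u) x).det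
    let m33 : ℝ := CorrSamp.minor33 a b (CorrSamp.corr P u) x
    let m32 : ℝ := CorrSamp.minor32 a b (CorrSamp.corr P u) x
    let m31 : ℝ := CorrSamp.minor31 a b (CorrSamp.corr P u) x
    let C : ℝ → Matrix (Fin 3) (Fin 3) ℝ := fun δ => CorrSamp.covMatrix P (CorrSamp.T u x δ)
    let lam : Fin 3 → ℝ → ℝ := fun k δ => CorrSamp.covEigenvalue P (CorrSamp.T u x δ) k
    -- `T(δ)` is a centered Gaussian vector with positive definite covariance matrix
    (∀ᶠ δ in 𝓝[>] (0 : ℝ), HasGaussianLaw (CorrSamp.T u x δ) P ∧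
      (∀ i, ∫ ω, CorrSamp.T u x δ ω i ∂P = 0) ∧ (C δ).PosDef) ∧
    -- the eigenvalues
    (∀ᶠ δ in 𝓝[>] (0 : ℝ), 0 < lam 0 δ ∧ lam 0 δ ≤ lam 1 δ ∧ lam 1 δ ≤ lam 2 δ) ∧
    ((fun δ => lam 0 δ - detR / (96 * m33) * δ ^ 4) =O[𝓝[>] 0] fun δ => δ ^ 5) ∧
    ((fun δ => lam 1 δ - m33 / (2 * R 0 0) * δ ^ 2) =O[𝓝[>] 0] fun δ => δ ^ 3) ∧
    ((fun δ => lam 2 δ - 3 * R 0 0) =O[𝓝[>] 0] fun δ => δ) ∧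
    -- the eigenvectors
    ∃ v : Fin 3 → ℝ → EuclideanSpace ℝ (Fin 3),
      (∀ᶠ δ in 𝓝[>] (0 : ℝ), Orthonormal ℝ (fun k => v k δ) ∧
        ∀ k, Matrix.toEuclideanLin (C δ) (v k δ) = lam k δ • v k δ) ∧
      Tendsto (v 0) (𝓝[>] 0) (𝓝 ((1 / √6) • !₂[1, -2, 1])) ∧
      Tendsto (v 1) (𝓝[>] 0) (𝓝 ((1 / √2) • !₂[1, 0, -1])) ∧
      Tendsto (v 2) (𝓝[>] 0) (𝓝 ((1 / √3) • !₂[1, 1, 1])) ∧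
      -- the projections of the threshold vector `τ(δ)`
      ∀ μ : ℝ → ℝ, ContDiffOn ℝ 3 μ (Icc a b) →
        let μ' : ℝ := derivWithin μ (Icc a b) x
        let μ'' : ℝ := iteratedDerivWithin 2 μ (Icc a b) x
        let τ : ℝ → EuclideanSpace ℝ (Fin 3) := fun δ => CorrSamp.sample μ x δ
        ((fun δ => inner ℝ (τ δ) (v 0 δ) -
            (m31 * μ x - m32 * μ' + m33 * μ'') / (4 * √6 * m33) * δ ^ 2)
          =O[𝓝[>] 0] fun δ => δ ^ 3) ∧
        ((fun δ => inner ℝ (τ δ) (v 1 δ) - (R 1 0 * μ x - R 0 0 * μ') / (√2 * R 0 0) * δ)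
          =O[𝓝[>] 0] fun δ => δ ^ 2) ∧
        ((fun δ => inner ℝ (τ δ) (v 2 δ) - √3 * μ x) =O[𝓝[>] 0] fun δ => δ) := by
  obtain ⟨hpos, hrest⟩ := lemma5p1_general P a b u (CorrSamp.memLp_of_gaussian h1.gaussian)
    h2.smooth x hx (h2.posDef x (Ico_subset_Icc_self hx))
  refine ⟨?_, hrest⟩
  filter_upwards [CorrSamp.eventually_hasGaussianLaw_T_and_centered h1 hx, hpos]
    with δ hT hC using ⟨hT.1, hT.2, hC⟩
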